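/- Let $d\ge 1$ and let $(X_1,Y_1),(X_2,Y_2),\dotsc$ and $(X,Y)$ be iid random pairs with values in $\mathbb{R}^d\times[0,1]$. Assume that the distribution $\mu$ of $X$ is the uniform distribution on a full-dimensional simple polytope $K\subset\mathbb{R}^d$ (the convex hull of finitely many points, with nonempty interior, each vertex of which lies in exactly $d$ facets). Let $\eta(x)=\mathbb{E}(Y\mid X=x)$ and $v(x)=\operatorname{var}(Y\mid X=x)$, and assume that there are $A,A'\ge 0$ and $\alpha,\alpha'>0$ such that for all $x,x'\in K$ \[ |\eta(x)-\eta(x')|\le A\|x-x'\|^{\alpha},\qquad |v(x)-v(x')|\le A'\|x-x'\|^{\alpha'} . \] Let $T$ be a scheme that assigns to every finite family of points $x_1,\dotsc,x_n$ that affinely spans $\mathbb{R}^d$ a Delaunay triangulation of it, that is, a set of non-degenerate $d$-simplices with vertices among the $x_i$ which cover $\operatorname{conv}(x_1,\dotsc,x_n)$, any two of which intersect in the (possibly empty) face spanned by their common vertices, and such that the open ball bounded by the circumscribed sphere of each simplex contains none of the $x_i$. Let $\hat\eta=\hat\eta_n$ be the simplicial interpolant of $(X_1,Y_1),\dotsc,(X_n,Y_n)$: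 for $x$ in the convex hull $\hat C$ of $X_1,\dotsc,X_n$, $\hat\eta(x)=\beta_0+x^{\top}\beta$, where $(\beta_0,\beta)$ is the unique solution of $\beta_0+X_i^{\top}\beta=Y_i$ for the $d+1$ vertices $X_i$ of a simplex of the triangulation $T$ of $X_1,\dotsc,X_n$ that contains $x$; and $\hat\eta(x)=1/2$ for $x\notin\hat C$. (If $n>d$, the points $X_1,\dotsc,X_n$ almost surely span $\mathbb{R}^d$.) Then, for every $n>d$, $(\hat\eta(X)-\eta(X))^2$ is integrable, and \[ \limsup_{n\to\infty}\mathbb{E}\bigl[(\hat\eta(X)-\eta(X))^2\bigr]\le\frac{2}{d+2}\,\mathbb{E}\bigl[(Y-\eta(X))^2\bigr], \] where the expectation on the left is over both the training data and the test example. -/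

import Mathlib

open MeasureTheory ProbabilityTheory Filter Set
open scoped NNReal ENNReal

namespace SimplicialInterpolation

/-- `F` is a facet of the full-dimensional polytope `K ⊆ ℝ^d`: a nonempty face (cut out by a
supporting hyperplane) whose affine dimension is `d - 1`. -/
def IsFacet {d : ℕ} (K F : Set (EuclideanSpace ℝ (Fin d))) : Prop :=
  F.Nonempty ∧ IsExposed ℝ K F ∧ Module.finrank ℝ (vectorSpan ℝ F) + 1 = d

/-- `K` is a full-dimensional simple polytope in `ℝ^d`: the convex hull of finitely many points,
with nonempty interior, each of whose vertices lies in exactly `d` facets. -/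
structure IsSimplePolytope {d : ℕ} (K : Set (EuclideanSpace ℝ (Fin d))) : Prop where
  isPolytope : ∃ V : Finset (EuclideanSpace ℝ (Fin d)),
    K = convexHull ℝ (V : Set (EuclideanSpace ℝ (Fin d)))
  interior_nonempty : (interior K).Nonempty
  simple : ∀ v ∈ extremePoints ℝ K,
    {F : Set (EuclideanSpace ℝ (Fin d)) | IsFacet K F ∧ v ∈ F}.encard = d

/-- The geometric simplex spanned by the points `x i`, `i ∈ s`. -/
def cell {d n : ℕ} (x : Fin n → EuclideanSpace ℝ (Fin d)) (s : Finset (Fin n)) :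
    Set (EuclideanSpace ℝ (Fin d)) :=
  convexHull ℝ (x '' (s : Set (Fin n)))

/-- `T` is a triangulation of the points `x 0, …, x (n-1)` in `ℝ^d`. A simplex is recorded by
the set of indices of its vertices. The simplices are non-degenerate `d`-simplices, they cover the
convex hull of the points, and two of them meet exactly in the face spanned by their common
vertices. -/
structure IsTriangulation {d n : ℕ} (x : Fin n → EuclideanSpace ℝ (Fin d))
    (T : Set (Finset (Fin n))) : Prop where
  card_eq : ∀ s ∈ T, s.card = d + 1
  nondegenerate : ∀ s ∈ T, AffineIndependent ℝ (fun i : s => x i)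
  cover : ⋃ s ∈ T, cell x s = convexHull ℝ (range x)
  inter : ∀ s ∈ T, ∀ t ∈ T, cell x s ∩ cell x t = cell x (s ∩ t)

/-- A Delaunay triangulation: the open ball bounded by the circumscribed sphere of any simplex
contains none of the points. -/
structure IsDelaunayTriangulation {d n : ℕ} (x : Fin n → EuclideanSpace ℝ (Fin d))
    (T : Set (Finset (Fin n))) : Prop extends IsTriangulation x T where
  empty_circumball : ∀ s ∈ T, ∃ (c : EuclideanSpace ℝ (Fin d)) (r : ℝ),
    (∀ i ∈ s, dist (x i) c = r) ∧ ∀ j, r ≤ dist (x j) c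

open Classical in
/-- The linear (affine) interpolation at `z` of the labeled points `(x i, y i)`, `i ∈ s`: the value
`β₀ + ⟨z, β⟩`, where `β₀ + ⟨x i, β⟩ = y i` for all `i ∈ s`. For a non-degenerate `d`-simplex the
solution `(β₀, β)` exists and is unique. -/
noncomputable def linearInterpolation {d n : ℕ} (x : Fin n → EuclideanSpace ℝ (Fin d))
    (y : Fin n → ℝ) (s : Finset (Fin n)) (z : EuclideanSpace ℝ (Fin d)) : ℝ :=
  if h : ∃ β : ℝ × EuclideanSpace ℝ (Fin d), ∀ i ∈ s, β.1 + inner ℝ (x i) β.2 = y i then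
    h.choose.1 + inner ℝ z h.choose.2
  else 0

open Classical in
/-- The simplicial interpolant of the labeled points `(x i, y i)` with respect to `T`: at a point
`z` of some simplex of `T`, the linear interpolation at `z` of the labels at the vertices of such a
simplex; `1 / 2` at all other points (those outside the convex hull of the points, if `T` is a
triangulation). -/
noncomputable def simplicialInterpolant {d n : ℕ} (T : Set (Finset (Fin n)))
    (x : Fin n → EuclideanSpace ℝ (Fin d)) (y : Fin n → ℝ)
    (z : EuclideanSpace ℝ (Fin d)) : ℝ :=
  if h : ∃ s ∈ T, z ∈ cell x s then linearInterpolation x y h.choose z else 1 / 2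

/-- The estimator `η̂` built from the random examples `(X i ω, Y i ω)`, `i < n`, with the
triangulation scheme `T`, which sees only the unlabeled points. -/
noncomputable def etaHat {d : ℕ} {Ω : Type*}
    (T : ∀ n : ℕ, (Fin n → EuclideanSpace ℝ (Fin d)) → Set (Finset (Fin n)))
    (X : ℕ → Ω → EuclideanSpace ℝ (Fin d)) (Y : ℕ → Ω → ℝ) (n : ℕ) (ω : Ω)
    (z : EuclideanSpace ℝ (Fin d)) : ℝ :=
  simplicialInterpolant (T n fun i : Fin n => X i ω) (fun i : Fin n => X i ω)
    (fun i : Fin n => Y i ω) z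

end SimplicialInterpolation

/-! The squared error splits into noise and bias. Almost surely the sample is in general position,
and then the barycentric weights `w_i(z)` of a point `z` in a Delaunay simplex do not depend on the
triangulation: they are determined by lying on an empty sphere (`GeneralPosition.weight_unique`). So
the arbitrary scheme `T` disappears, and the interpolant is `∑ w_i(z) Y_i`, or `1/2` off the hull
(`IsDelaunayTriangulation.simplicialInterpolant_eq`).

Noise. Given the points, distinct noise terms are uncorrelated, so the noise has second moment `E ∑
w_i² v(X_i)`. For a fixed vertex, `w_i` is a cone function on the star of `X_i`: the set `{w_i > t}`
is the homothetic copy, of ratio `1 - t`, of `{w_i > 0}` and has `(1 - t)^d` times its volume.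
Layer-cake integration gives `∫ w_i = vol/(d+1)` and `∫ w_i² = 2 vol/((d+1)(d+2))`, where `vol` is
the volume of the star. Hence `∫ w_i² = 2/(d+2) ∫ w_i`, an exact identity for every sample in
general position. As the test point is uniform on `K` and the stars lie in `K`, the noise
contributes exactly `2/(d+2) E ∑ w_i v(X_i)` (`integral_sq_sum_noise_delaunayWeight`).

Limit. The sample becomes dense in `K`, so empty spheres around an interior point shrink, and `∑ w_i
g(X_i)` tends to `g(X₀)` for every `g` continuous on `K` (`tendsto_sum_delaunayWeight`). With `g =
η` and `g = 1` the bias vanishes; with `g = v` the noise tends to `2/(d+2) E v(X₀)`. All quantities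
are bounded, so dominated convergence applies; the limsup is in fact a limit, with equality. -/

namespace SimplicialInterpolation

open Topology

/-! ### Delaunay weights and the interpolant in general position -/

/-- `w` is the vector of barycentric coordinates of `z` with respect to some points among the `x i`
that lie on a sphere whose open ball contains none of the `x j`. -/
def IsDelaunayWeight {d n : ℕ} (x : Fin n → EuclideanSpace ℝ (Fin d))
    (z : EuclideanSpace ℝ (Fin d)) (w : Fin n → ℝ) : Prop :=
  w ∈ stdSimplex ℝ (Fin n) ∧ ∑ i, w i • x i = z ∧
    ∃ (c : EuclideanSpace ℝ (Fin d)) (r : ℝ), (∀ j, r ≤ dist (x j) c) ∧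
      ∀ i, w i ≠ 0 → dist (x i) c = r

/-- Any `d + 1` of the points are affinely independent, and no `d + 2` of them are cospherical. -/
structure GeneralPosition {d n : ℕ} (x : Fin n → EuclideanSpace ℝ (Fin d)) : Prop where
  affineIndependent : ∀ s : Finset (Fin n), s.card ≤ d + 1 →
    AffineIndependent ℝ (fun i : s => x i)
  card_sphere_le : ∀ (c : EuclideanSpace ℝ (Fin d)) (r : ℝ) (s : Finset (Fin n)),
    (∀ i ∈ s, dist (x i) c = r) → s.card ≤ d + 1

open Classical in
/-- The Delaunay weights of `z`, or zero if there are none. -/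
noncomputable def delaunayWeight {d n : ℕ} (x : Fin n → EuclideanSpace ℝ (Fin d))
    (z : EuclideanSpace ℝ (Fin d)) : Fin n → ℝ :=
  if h : ∃ w, IsDelaunayWeight x z w then h.choose else 0

variable {d n : ℕ} {x : Fin n → EuclideanSpace ℝ (Fin d)} {z : EuclideanSpace ℝ (Fin d)}
  {w : Fin n → ℝ}

theorem AffineIndependent.eq_zero_of_sum_smul_eq_zero {s : Finset (Fin n)}
    (hs : AffineIndependent ℝ (fun i : s => x i)) {u : Fin n → ℝ} (hu : ∀ i ∉ s, u i = 0)
    (hu0 : ∑ i, u i = 0) (hux : ∑ i, u i • x i = 0) : u = 0 := by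
  have h1 : ∑ i : s, u i = 0 := by
    rw [Finset.sum_coe_sort s u, ← hu0]
    exact Finset.sum_subset (Finset.subset_univ _) fun i _ hi => hu i hi
  have h2 : ∑ i : s, u i • x i = 0 := by
    rw [Finset.sum_coe_sort s fun i => u i • x i, ← hux]
    exact Finset.sum_subset (Finset.subset_univ _) fun i _ hi => by simp [hu i hi]
  funext i
  by_cases hi : i ∈ s
  · exact affineIndependent_iff.1 hs Finset.univ (fun i => u i) h1 h2 ⟨i, hi⟩ (Finset.mem_univ _)
  · exact hu i hi

/-- The difference of two power functions is an affine function. -/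
theorem sum_mul_power_sub_power {ι : Type*} [Fintype ι] {x : ι → EuclideanSpace ℝ (Fin d)}
    {w : ι → ℝ} {c c' : EuclideanSpace ℝ (Fin d)} {r r' : ℝ}
    (hw1 : ∑ i, w i = 1) (hwz : ∑ i, w i • x i = z) :
    ∑ i, w i * ((dist (x i) c ^ 2 - r ^ 2) - (dist (x i) c' ^ 2 - r' ^ 2)) =
      (dist z c ^ 2 - r ^ 2) - (dist z c' ^ 2 - r' ^ 2) := by
  have h : ∀ y : EuclideanSpace ℝ (Fin d), (dist y c ^ 2 - r ^ 2) - (dist y c' ^ 2 - r' ^ 2) =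
      2 * inner ℝ y (c' - c) + (‖c‖ ^ 2 - r ^ 2 - ‖c'‖ ^ 2 + r' ^ 2) := by
    intro y
    rw [dist_eq_norm, dist_eq_norm, norm_sub_sq_real, norm_sub_sq_real, inner_sub_right]
    ring
  have h' : ∀ i, w i * (2 * inner ℝ (x i) (c' - c) + (‖c‖ ^ 2 - r ^ 2 - ‖c'‖ ^ 2 + r' ^ 2)) =
      2 * inner ℝ (w i • x i) (c' - c) + w i * (‖c‖ ^ 2 - r ^ 2 - ‖c'‖ ^ 2 + r' ^ 2) := by
    intro i
    rw [inner_smul_left]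
    simp
    ring
  simp only [h, h']
  rw [Finset.sum_add_distrib, ← Finset.mul_sum, ← sum_inner, hwz, ← Finset.sum_mul, hw1, one_mul]

theorem IsDelaunayWeight.radius_nonneg {c : EuclideanSpace ℝ (Fin d)} {r : ℝ}
    (hw : w ∈ stdSimplex ℝ (Fin n)) (h : ∀ i, w i ≠ 0 → dist (x i) c = r) : 0 ≤ r := by
  have : ∃ i, w i ≠ 0 := by
    by_contra! h0
    have := hw.2
    simp [h0] at this
  obtain ⟨i, hi⟩ := this
  rw [← h i hi]
  exact dist_nonneg

/-- The powers of a point with respect to the two empty spheres differ by an affine function, so the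
average of this difference is the same under `w` and `w'`. Each power vanishes on its own vertices
and is nonnegative at all points, so the average is at most zero under `w` and at least zero under
`w'`. Hence it is zero, and the vertices of `w` lie on the second sphere too. General position makes
the points on that sphere affinely independent, so barycentric coordinates are unique. -/
theorem GeneralPosition.weight_unique (hx : GeneralPosition x) {w' : Fin n → ℝ}
    (hw : IsDelaunayWeight x z w) (hw' : IsDelaunayWeight x z w') : w = w' := by
  obtain ⟨hs, hz, c, r, hcr, hc⟩ := hw
  obtain ⟨hs', hz', c', r', hcr', hc'⟩ := hw'
  have hr := IsDelaunayWeight.radius_nonneg hs hc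
  have hr' := IsDelaunayWeight.radius_nonneg hs' hc'
  have key := (sum_mul_power_sub_power (c := c) (c' := c') (r := r) (r' := r') hs.2 hz).trans
    (sum_mul_power_sub_power (c := c) (c' := c') (r := r) (r' := r') hs'.2 hz').symm
  have e1 : ∑ i, w i * ((dist (x i) c ^ 2 - r ^ 2) - (dist (x i) c' ^ 2 - r' ^ 2)) =
      - ∑ i, w i * (dist (x i) c' ^ 2 - r' ^ 2) := by
    rw [← Finset.sum_neg_distrib]
    refine Finset.sum_congr rfl fun i _ => ?_
    by_cases h : w i = 0
    · simp [h]
    · rw [hc i h]; ring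
  have e2 : 0 ≤ ∑ i, w' i * ((dist (x i) c ^ 2 - r ^ 2) - (dist (x i) c' ^ 2 - r' ^ 2)) := by
    refine Finset.sum_nonneg fun i _ => ?_
    by_cases h : w' i = 0
    · simp [h]
    · rw [hc' i h]
      have := pow_le_pow_left₀ hr (hcr i) 2
      exact mul_nonneg (hs'.1 i) (by linarith)
  have hnn : ∀ i, 0 ≤ w i * (dist (x i) c' ^ 2 - r' ^ 2) := fun i =>
    mul_nonneg (hs.1 i) (by linarith [pow_le_pow_left₀ hr' (hcr' i) 2])
  have e3 : ∑ i, w i * (dist (x i) c' ^ 2 - r' ^ 2) = 0 :=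
    le_antisymm (by linarith) (Finset.sum_nonneg fun i _ => hnn i)
  have e4 := (Finset.sum_eq_zero_iff_of_nonneg fun i _ => hnn i).1 e3
  have hon : ∀ i, w i ≠ 0 → dist (x i) c' = r' := fun i hi => by
    have := (mul_eq_zero.1 (e4 i (Finset.mem_univ _))).resolve_left hi
    exact (pow_left_inj₀ dist_nonneg hr' two_ne_zero).1 (by linarith)
  have hind := hx.affineIndependent (Finset.univ.filter fun i => dist (x i) c' = r')
    (hx.card_sphere_le c' r' _ (by simp))
  have := AffineIndependent.eq_zero_of_sum_smul_eq_zero hind (u := w - w') ?_ ?_ ?_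
  · exact sub_eq_zero.1 this
  · intro i hi
    simp only [Finset.mem_filter, Finset.mem_univ, true_and] at hi
    simp [not_imp_comm.1 (hon i) hi, not_imp_comm.1 (hc' i) hi]
  · simp [hs.2, hs'.2]
  · simp [sub_smul, hz, hz']

theorem GeneralPosition.delaunayWeight_eq (hx : GeneralPosition x)
    (hw : IsDelaunayWeight x z w) : delaunayWeight x z = w := by
  have h : ∃ w, IsDelaunayWeight x z w := ⟨w, hw⟩
  rw [delaunayWeight, dif_pos h]
  exact hx.weight_unique h.choose_spec hw

theorem isDelaunayWeight_or_eq_zero :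
    IsDelaunayWeight x z (delaunayWeight x z) ∨
      (¬ (∃ w, IsDelaunayWeight x z w) ∧ delaunayWeight x z = 0) := by
  by_cases h : ∃ w, IsDelaunayWeight x z w
  · rw [delaunayWeight, dif_pos h]
    exact .inl h.choose_spec
  · exact .inr ⟨h, dif_neg h⟩

theorem delaunayWeight_nonneg (i : Fin n) : 0 ≤ delaunayWeight x z i := by
  rcases isDelaunayWeight_or_eq_zero (x := x) (z := z) with h | h
  · exact h.1.1 i
  · simp [h.2]

theorem sum_delaunayWeight_le : ∑ i, delaunayWeight x z i ≤ 1 := by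
  rcases isDelaunayWeight_or_eq_zero (x := x) (z := z) with h | h
  · exact h.1.2.le
  · simp [h.2]

theorem IsDelaunayWeight.mem_convexHull (hw : IsDelaunayWeight x z w) :
    z ∈ convexHull ℝ (range x) := by
  rw [← hw.2.1]
  exact (convex_convexHull ℝ _).sum_mem (fun i _ => hw.1.1 i) hw.1.2
    fun i _ => subset_convexHull ℝ _ (mem_range_self i)

/-- Points of a simplex are convex combinations of its vertices. -/
theorem exists_weight_of_mem_cell {s : Finset (Fin n)} (hz : z ∈ cell x s) :
    ∃ w ∈ stdSimplex ℝ (Fin n), (∀ i ∉ s, w i = 0) ∧ ∑ i, w i • x i = z := by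
  classical
  have himg : x '' (s : Set (Fin n)) = range (fun i : s => x i) := by
    ext p; simp
  rw [cell, himg, convexHull_range_eq_exists_affineCombination] at hz
  obtain ⟨t, u, hu0, hu1, rfl⟩ := hz
  rw [Finset.affineCombination_eq_linear_combination _ _ _ hu1]
  let w : Fin n → ℝ := fun i => if h : i ∈ s then (if ⟨i, h⟩ ∈ t then u ⟨i, h⟩ else 0) else 0
  have hwoff : ∀ i ∉ s, w i = 0 := fun i hi => by simp [w, hi]
  have hwon : ∀ i : s, w i = if i ∈ t then u i else 0 := fun i => by simp [w]
  refine ⟨w, ⟨fun i => ?_, ?_⟩, hwoff, ?_⟩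
  · by_cases hi : i ∈ s
    · rw [hwon ⟨i, hi⟩]
      split_ifs with h
      · exact hu0 _ h
      · exact le_rfl
    · rw [hwoff i hi]
  · rw [← hu1, ← Finset.sum_subset (Finset.subset_univ s) fun i _ hi => hwoff i hi,
      ← Finset.sum_coe_sort s w]
    simp only [hwon, Finset.univ_eq_attach, Finset.sum_ite_mem]
    exact Finset.sum_congr (by ext; simp) fun _ _ => rfl
  · rw [← Finset.sum_subset (Finset.subset_univ s) fun i _ hi => by simp [hwoff i hi],
      ← Finset.sum_coe_sort s fun i => w i • x i]
    simp only [hwon, ite_smul, zero_smul, Finset.univ_eq_attach, Finset.sum_ite_mem]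
    exact Finset.sum_congr (by ext; simp) fun _ _ => rfl

/-- Affine independence of the `x i` is linear independence of the vectors `(1, x i)`, so some
linear functional takes the prescribed labels on them; this solves for `β`. An affine function
commutes with barycentric combinations. -/
theorem linearInterpolation_eq_sum {s : Finset (Fin n)} {y : Fin n → ℝ}
    (hs : AffineIndependent ℝ (fun i : s => x i)) (hws : ∀ i ∉ s, w i = 0)
    (hw1 : ∑ i, w i = 1) (hwz : ∑ i, w i • x i = z) :
    linearInterpolation x y s z = ∑ i, w i * y i := by
  have hex : ∃ β : ℝ × EuclideanSpace ℝ (Fin d), ∀ i ∈ s, β.1 + inner ℝ (x i) β.2 = y i := by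
    have hli : LinearIndependent ℝ (fun i : s => ((1 : ℝ), x i)) := by
      rw [linearIndependent_iff']
      intro t g hg i hi
      have h1 := congrArg Prod.fst hg
      have h2 := congrArg Prod.snd hg
      simp only [Prod.fst_sum, Prod.snd_sum, Prod.smul_fst, Prod.smul_snd, Prod.fst_zero,
        Prod.snd_zero, smul_eq_mul, mul_one] at h1 h2
      exact affineIndependent_iff.1 hs t g h1 h2 i hi
    obtain ⟨g, hg⟩ := LinearMap.exists_extend
      ((Finsupp.linearCombination ℝ fun i : s => y i) ∘ₗ hli.repr)
    have hgx : ∀ i : s, g (1, x i) = y i := fun i => by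
      have := LinearMap.congr_fun hg ⟨(1, x i), Submodule.subset_span (mem_range_self i)⟩
      simpa [hli.repr_eq_single i ⟨(1, x i), Submodule.subset_span (mem_range_self i)⟩ rfl]
        using this
    let f := LinearMap.toContinuousLinearMap (g ∘ₗ LinearMap.inr ℝ ℝ (EuclideanSpace ℝ (Fin d)))
    refine ⟨(g (1, 0), (InnerProductSpace.toDual ℝ _).symm f), fun i hi => ?_⟩
    rw [real_inner_comm, InnerProductSpace.toDual_symm_apply, ← hgx ⟨i, hi⟩]
    simp [f, ← map_add]
  rw [linearInterpolation, dif_pos hex]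
  have hβ := hex.choose_spec
  set β := hex.choose
  have : ∀ i, w i * y i = w i * β.1 + inner ℝ (w i • x i) β.2 := fun i => by
    by_cases hi : i ∈ s
    · rw [← hβ i hi, inner_smul_left]
      simp; ring
    · simp [hws i hi]
  rw [Finset.sum_congr rfl fun i _ => this i, Finset.sum_add_distrib, ← Finset.sum_mul, hw1,
    one_mul, ← sum_inner, hwz]

theorem IsDelaunayTriangulation.isDelaunayWeight {T : Set (Finset (Fin n))}
    (hT : IsDelaunayTriangulation x T) {s : Finset (Fin n)} (hs : s ∈ T)
    (hw : w ∈ stdSimplex ℝ (Fin n)) (hws : ∀ i ∉ s, w i = 0) (hwz : ∑ i, w i • x i = z) :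
    IsDelaunayWeight x z w := by
  obtain ⟨c, r, h1, h2⟩ := hT.empty_circumball s hs
  exact ⟨hw, hwz, c, r, h2, fun i hi => h1 i (not_imp_comm.1 (hws i) hi)⟩

theorem IsDelaunayTriangulation.exists_weight {T : Set (Finset (Fin n))}
    (hT : IsDelaunayTriangulation x T) (hz : z ∈ convexHull ℝ (range x)) :
    ∃ w, IsDelaunayWeight x z w := by
  rw [← hT.cover] at hz
  simp only [mem_iUnion] at hz
  obtain ⟨s, hs, hzs⟩ := hz
  obtain ⟨w, hw, hws, hwz⟩ := exists_weight_of_mem_cell hzs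
  exact ⟨w, hT.isDelaunayWeight hs hw hws hwz⟩

/-- The right side is free of `T`, which carries no measurability. Its last term is the default
value: it vanishes where weights exist, and off the hull all weights are zero and it equals `1 / 2`.
-/
theorem IsDelaunayTriangulation.simplicialInterpolant_eq {T : Set (Finset (Fin n))}
    (hT : IsDelaunayTriangulation x T) (hx : GeneralPosition x) (y : Fin n → ℝ) :
    simplicialInterpolant T x y z = ∑ i, delaunayWeight x z i * y i +
      (1 / 2) * (1 - ∑ i, delaunayWeight x z i) := by
  by_cases h : ∃ s ∈ T, z ∈ cell x s
  · rw [simplicialInterpolant, dif_pos h]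
    obtain ⟨hs, hz⟩ := h.choose_spec
    obtain ⟨w, hw, hws, hwz⟩ := exists_weight_of_mem_cell hz
    rw [linearInterpolation_eq_sum (hT.nondegenerate _ hs) hws hw.2 hwz,
      hx.delaunayWeight_eq (hT.isDelaunayWeight hs hw hws hwz), hw.2]
    ring
  · rw [simplicialInterpolant, dif_neg h]
    have h0 : ¬ ∃ w, IsDelaunayWeight x z w := by
      rintro ⟨w, hw⟩
      have := hw.mem_convexHull
      rw [← hT.cover] at this
      simp only [mem_iUnion] at this
      obtain ⟨s, hs, hzs⟩ := this
      exact h ⟨s, hs, hzs⟩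
    rw [delaunayWeight, dif_neg h0]
    simp

end SimplicialInterpolation

/-! ### Stars of vertices and moments of the weights -/

namespace SimplicialInterpolation

open Topology

variable {d n : ℕ} {x : Fin n → EuclideanSpace ℝ (Fin d)} {z : EuclideanSpace ℝ (Fin d)}
  {w : Fin n → ℝ}

/-- Moving a point towards a vertex with positive weight preserves the circumscribed sphere. -/
theorem IsDelaunayWeight.homothety (hw : IsDelaunayWeight x z w) {i : Fin n} (hi : 0 < w i)
    {t : ℝ} (ht : 0 ≤ t) (ht' : t ≤ 1) :
    IsDelaunayWeight x (AffineMap.homothety (x i) (1 - t) z)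
      (fun j => (1 - t) * w j + if j = i then t else 0) := by
  obtain ⟨hs, hz, c, r, hcr, hc⟩ := hw
  refine ⟨⟨fun j => ?_, ?_⟩, ?_, c, r, hcr, fun j hj => ?_⟩
  · have := mul_nonneg (sub_nonneg.2 ht') (hs.1 j)
    dsimp only
    split_ifs <;> linarith
  · simp [Finset.sum_add_distrib, ← Finset.mul_sum, hs.2]
  · simp only [add_smul, Finset.sum_add_distrib, ite_smul, zero_smul, Finset.sum_ite_eq',
      Finset.mem_univ, if_true, mul_smul, ← Finset.smul_sum, hz, AffineMap.homothety_apply,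
      vsub_eq_sub, vadd_eq_add]
    module
  · by_cases hji : j = i
    · exact hji ▸ hc i hi.ne'
    · refine hc j fun h0 => hj ?_
      simp [hji, h0]

/-- Inverse of the previous move: taking mass `t` off vertex `i` and renormalising by `1 - t` pushes
`z` away from `x i` on the same empty sphere. -/
theorem IsDelaunayWeight.exists_homothety (hw : IsDelaunayWeight x z w) {i : Fin n} {t : ℝ}
    (ht : 0 ≤ t) (hi : t < w i) :
    ∃ z' w', IsDelaunayWeight x z' w' ∧ 0 < w' i ∧ AffineMap.homothety (x i) (1 - t) z' = z := by
  obtain ⟨hs, hz, c, r, hcr, hc⟩ := hw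
  have ht1 : 0 < 1 - t := by
    have := Finset.single_le_sum (fun j _ => hs.1 j) (Finset.mem_univ i)
    rw [hs.2] at this
    linarith
  let w' : Fin n → ℝ := fun j => (1 - t)⁻¹ * (w j - if j = i then t else 0)
  have hsum : ∑ j, w' j • x j = (1 - t)⁻¹ • (z - t • x i) := by
    simp only [w', mul_smul, ← Finset.smul_sum, sub_smul, Finset.sum_sub_distrib, hz, ite_smul,
      zero_smul, Finset.sum_ite_eq', Finset.mem_univ, if_true]
  refine ⟨(1 - t)⁻¹ • (z - t • x i), w', ⟨⟨fun j => ?_, ?_⟩, hsum, c, r, hcr, fun j hj => ?_⟩,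
    ?_, ?_⟩
  · refine mul_nonneg (inv_nonneg.2 ht1.le) ?_
    split_ifs with h
    · rw [h]; linarith
    · linarith [hs.1 j]
  · simp only [w', ← Finset.mul_sum, Finset.sum_sub_distrib, hs.2, Finset.sum_ite_eq',
      Finset.mem_univ, if_true]
    field_simp
  · by_cases hji : j = i
    · exact hji ▸ hc i (by linarith)
    · refine hc j fun h0 => hj ?_
      simp [w', hji, h0]
  · simp only [w', if_true]
    exact mul_pos (inv_pos.2 ht1) (by linarith)
  · simp only [AffineMap.homothety_apply, vsub_eq_sub, vadd_eq_add, smul_sub, smul_smul,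
      mul_inv_cancel₀ ht1.ne']
    rw [← mul_assoc, mul_inv_cancel₀ ht1.ne']
    module

theorem GeneralPosition.setOf_lt_delaunayWeight (hx : GeneralPosition x) (i : Fin n) {t : ℝ}
    (ht : 0 ≤ t) (ht' : t < 1) :
    {z | t < delaunayWeight x z i} =
      AffineMap.homothety (x i) (1 - t) '' {z | 0 < delaunayWeight x z i} := by
  ext z
  simp only [mem_ofPred_eq, mem_image]
  constructor
  · intro h
    rcases isDelaunayWeight_or_eq_zero (x := x) (z := z) with hw | hw
    · obtain ⟨z', w', hw', hpos, hz'⟩ := hw.exists_homothety ht h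
      exact ⟨z', by rwa [hx.delaunayWeight_eq hw'], hz'⟩
    · rw [hw.2] at h
      exact absurd h (by simpa using ht)
  · rintro ⟨z', h, rfl⟩
    rcases isDelaunayWeight_or_eq_zero (x := x) (z := z') with hw | hw
    · rw [hx.delaunayWeight_eq (hw.homothety h ht ht'.le)]
      simp only [if_true]
      nlinarith
    · rw [hw.2] at h
      exact absurd h (by simp)

theorem delaunayWeight_le_one (i : Fin n) : delaunayWeight x z i ≤ 1 :=
  (Finset.single_le_sum (fun j _ => delaunayWeight_nonneg j) (Finset.mem_univ i)).trans
    sum_delaunayWeight_le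

theorem GeneralPosition.volume_setOf_lt_delaunayWeight (hx : GeneralPosition x) (i : Fin n) {t : ℝ}
    (ht : 0 ≤ t) (ht' : t < 1) :
    volume {z | t < delaunayWeight x z i} =
      ENNReal.ofReal ((1 - t) ^ d) * volume {z | 0 < delaunayWeight x z i} := by
  rw [hx.setOf_lt_delaunayWeight i ht ht', Measure.addHaar_image_homothety]
  simp [abs_of_pos (sub_pos.2 ht')]

/-- Layer cake with density `(k + 1) t ^ k`; the tail volumes are those of the shrunken star, and
levels `t ≥ 1` contribute nothing. -/
theorem GeneralPosition.lintegral_comp_delaunayWeight (hx : GeneralPosition x) (i : Fin n)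
    (hm : AEMeasurable (fun z => delaunayWeight x z i) volume) (k : ℕ) :
    ∫⁻ z, ENNReal.ofReal (delaunayWeight x z i ^ (k + 1)) =
      ENNReal.ofReal (∫ t in (0 : ℝ)..1, (k + 1) * t ^ k * (1 - t) ^ d) *
        volume {z | 0 < delaunayWeight x z i} := by
  have hint : ∀ y : ℝ, ∫ t in (0 : ℝ)..y, ((k : ℝ) + 1) * t ^ k = y ^ (k + 1) := fun y => by
    rw [intervalIntegral.integral_const_mul, integral_pow]
    field_simp
    simp
  have hc := lintegral_comp_eq_lintegral_meas_lt_mul (volume : Measure (EuclideanSpace ℝ (Fin d)))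
    (f := fun z => delaunayWeight x z i) (g := fun t => ((k : ℝ) + 1) * t ^ k)
    (Eventually.of_forall fun z => delaunayWeight_nonneg i) hm
    (fun t _ => Continuous.intervalIntegrable (by fun_prop) _ _)
    ((ae_restrict_iff' measurableSet_Ioi).2 (Eventually.of_forall fun t (ht : 0 < t) => by
      positivity))
  simp only [hint] at hc
  rw [hc]
  have hzero : ∀ t : ℝ, 1 ≤ t → {z | t < delaunayWeight x z i} = ∅ := fun t ht => by
    ext z
    simpa using (delaunayWeight_le_one i).trans ht
  have hind : ∀ t : ℝ, volume {z | t < delaunayWeight x z i} * ENNReal.ofReal ((k + 1) * t ^ k) =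
      (Iio (1 : ℝ)).indicator (fun t => volume {z | t < delaunayWeight x z i} *
        ENNReal.ofReal ((k + 1) * t ^ k)) t := fun t => by
    by_cases ht : t < 1
    · rw [indicator_of_mem (mem_Iio.2 ht)]
    · rw [indicator_of_notMem (by simpa using ht), hzero t (not_lt.1 ht)]
      simp
  rw [lintegral_congr hind, setLIntegral_indicator measurableSet_Iio, inter_comm, Ioi_inter_Iio]
  rw [intervalIntegral.integral_of_le zero_le_one, integral_Ioc_eq_integral_Ioo,
    ofReal_integral_eq_lintegral_ofReal, ← lintegral_mul_const]
  · refine setLIntegral_congr_fun measurableSet_Ioo fun t ht => ?_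
    rw [hx.volume_setOf_lt_delaunayWeight i ht.1.le ht.2, ENNReal.ofReal_mul (q := (1 - t) ^ d)]
    · ring
    · have := ht.1; positivity
  · fun_prop
  · exact (Continuous.integrableOn_Icc (by fun_prop)).mono_set Ioo_subset_Icc_self
  · refine (ae_restrict_iff' measurableSet_Ioo).2 (Eventually.of_forall fun t ht => ?_)
    have := ht.1
    have := sub_pos.2 ht.2
    positivity

theorem integral_one_sub_pow (m : ℕ) : ∫ t in (0 : ℝ)..1, (1 - t) ^ m = 1 / (m + 1) := by
  rw [intervalIntegral.integral_comp_sub_left (fun t => t ^ m)]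
  simp

theorem integral_mul_one_sub_pow (m : ℕ) :
    ∫ t in (0 : ℝ)..1, 2 * t * (1 - t) ^ m = 2 / ((m + 1) * (m + 2)) := by
  have : ∀ t : ℝ, 2 * t * (1 - t) ^ m = 2 * ((1 - t) ^ m - (1 - t) ^ (m + 1)) := fun t => by ring
  simp only [this]
  rw [intervalIntegral.integral_const_mul, intervalIntegral.integral_sub, integral_one_sub_pow,
    integral_one_sub_pow]
  · push_cast
    field_simp
    ring
  all_goals exact Continuous.intervalIntegrable (by fun_prop) _ _

/-- The moments for `k = 0` and `k = 1` are the star's volume times `1/(d+1)` and `2/((d+1)(d+2))`;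
the volume cancels. -/
theorem GeneralPosition.lintegral_sq_delaunayWeight (hx : GeneralPosition x) (i : Fin n)
    (hm : AEMeasurable (fun z => delaunayWeight x z i) volume) :
    ∫⁻ z, ENNReal.ofReal (delaunayWeight x z i ^ 2) =
      ENNReal.ofReal (2 / (d + 2)) * ∫⁻ z, ENNReal.ofReal (delaunayWeight x z i) := by
  have h1 := hx.lintegral_comp_delaunayWeight i hm 0
  have h2 := hx.lintegral_comp_delaunayWeight i hm 1
  simp only [zero_add, pow_one, Nat.cast_zero, pow_zero, one_mul, integral_one_sub_pow,
    Nat.cast_one, one_add_one_eq_two, integral_mul_one_sub_pow] at h1 h2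
  rw [h1, h2, ← mul_assoc, ← ENNReal.ofReal_mul (by positivity)]
  congr 2
  field_simp

/-! ### Delaunay cells shrink when the points fill a neighbourhood -/

theorem exists_ball_subset_of_mem_closedBall {c p : EuclideanSpace ℝ (Fin d)} {r ρ : ℝ}
    (hρ : 0 < ρ) (hr : ρ ≤ r) (hp : dist p c ≤ r) :
    ∃ q ∈ Metric.closedBall p ρ, Metric.ball q ρ ⊆ Metric.ball c r := by
  rcases le_or_gt (dist p c) ρ with h | h
  · exact ⟨c, by rwa [Metric.mem_closedBall, dist_comm], Metric.ball_subset_ball hr⟩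
  · have h0 : 0 < dist p c := hρ.trans h
    have hle : ρ / dist p c ≤ 1 := (div_le_one h0).2 h.le
    refine ⟨AffineMap.lineMap p c (ρ / dist p c), ?_, Metric.ball_subset_ball' ?_⟩
    · rw [Metric.mem_closedBall, dist_lineMap_left, Real.norm_of_nonneg (by positivity)]
      field_simp
      exact le_rfl
    · rw [dist_lineMap_right, Real.norm_of_nonneg (by linarith), sub_mul,
        div_mul_cancel₀ _ h0.ne']
      linarith

/-- By convexity `z` lies in the closed ball bounded by its empty sphere. If the radius were at
least `ρ`, that ball would contain an open ball of radius `ρ` centred within `ρ` of `z`, hence a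
sample point. So the diameter is below `2 * ρ`. -/
theorem IsDelaunayWeight.dist_lt {ρ : ℝ} (hρ : 0 < ρ) (hw : IsDelaunayWeight x z w)
    (hfill : ∀ q ∈ Metric.closedBall z ρ, ∃ j, x j ∈ Metric.ball q ρ) {i : Fin n} (hi : w i ≠ 0) :
    dist (x i) z < 2 * ρ := by
  obtain ⟨hs, hz, c, r, hcr, hc⟩ := hw
  have hzc : dist z c ≤ r := by
    rw [← Metric.mem_closedBall, ← hz, ← Finset.sum_filter_of_ne (p := fun i => w i ≠ 0)
      (fun i _ h h0 => h (by simp [h0]))]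
    refine (convex_closedBall c r).sum_mem (fun i _ => hs.1 i) ?_ fun j hj => ?_
    · rw [Finset.sum_filter_ne_zero, hs.2]
    · exact (hc j (Finset.mem_filter.1 hj).2).le
  have hr : r < ρ := by
    by_contra! hr
    obtain ⟨q, hq, hsub⟩ := exists_ball_subset_of_mem_closedBall hρ hr hzc
    obtain ⟨j, hj⟩ := hfill q hq
    exact (hcr j).not_gt (hsub hj)
  calc dist (x i) z ≤ dist (x i) c + dist z c := dist_triangle_right _ _ _
    _ < 2 * ρ := by rw [hc i hi]; linarith

theorem mem_convexHull_of_fill {ρ : ℝ} (hρ : 0 < ρ)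
    (hfill : ∀ q ∈ Metric.closedBall z ρ, ∃ j, x j ∈ Metric.ball q ρ) :
    z ∈ convexHull ℝ (range x) := by
  by_contra hz
  obtain ⟨f, u, hfu, hu⟩ := geometric_hahn_banach_closed_point (convex_convexHull ℝ (range x))
    ((finite_range x).isClosed_convexHull ℝ) hz
  set a := (InnerProductSpace.toDual ℝ _).symm f with ha
  have hfa : ∀ y, f y = inner ℝ a y := fun y => by
    rw [ha, InnerProductSpace.toDual_symm_apply]
  have ha0 : a ≠ 0 := by
    rintro h0
    obtain ⟨j, hj⟩ := hfill z (Metric.mem_closedBall_self hρ.le)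
    have := hfu (x j) (subset_convexHull ℝ _ (mem_range_self j))
    simp only [hfa, h0, inner_zero_left] at this hu
    linarith
  have hna : 0 < ‖a‖ := norm_pos_iff.2 ha0
  -- The open ball of radius `ρ` about this centre lies strictly beyond the hyperplane through `z`
  -- with normal `a`, on the side free of sample points.
  obtain ⟨j, hj⟩ := hfill (z + (ρ / ‖a‖) • a) (by
    rw [Metric.mem_closedBall, dist_self_add_left, norm_smul, Real.norm_of_nonneg (by positivity)]
    field_simp
    exact le_rfl)
  have h1 := hfu (x j) (subset_convexHull ℝ _ (mem_range_self j))
  rw [hfa] at h1 hu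
  have h2 : inner ℝ a (z + (ρ / ‖a‖) • a - x j) < ‖a‖ * ρ := by
    refine (real_inner_le_norm _ _).trans_lt ?_
    rw [Metric.mem_ball, dist_comm, dist_eq_norm] at hj
    exact mul_lt_mul_of_pos_left hj hna
  rw [inner_sub_right, inner_add_right, inner_smul_right, real_inner_self_eq_norm_sq] at h2
  have h3 : ρ / ‖a‖ * ‖a‖ ^ 2 = ‖a‖ * ρ := by field_simp
  linarith

/-- If a sequence meets every open ball contained in a neighbourhood of `z`, its first `n` terms
meet all the balls of a fixed radius near `z`, for `n` large. -/
theorem eventually_fill {p : ℕ → EuclideanSpace ℝ (Fin d)} {δ ρ : ℝ} (hρ : 0 < ρ)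
    (hρδ : 2 * ρ ≤ δ)
    (hp : ∀ q r, 0 < r → Metric.ball q r ⊆ Metric.ball z δ → ∃ i, p i ∈ Metric.ball q r) :
    ∀ᶠ n in atTop, ∀ q ∈ Metric.closedBall z ρ, ∃ j : Fin n, p j ∈ Metric.ball q ρ := by
  refine (isCompact_closedBall z ρ).induction_on
    (p := fun S => ∀ᶠ n in atTop, ∀ q ∈ S, ∃ j : Fin n, p j ∈ Metric.ball q ρ) (by simp)
    (fun s t hst ht => ht.mono fun n hn q hq => hn q (hst hq))
    (fun s t hs ht => (hs.and ht).mono fun n hn q hq => hq.elim (hn.1 q) (hn.2 q))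
    fun q hq => ?_
  -- A sample point within `ρ / 2` of `q` serves every centre within `ρ / 2` of `q`, so compactness
  -- leaves finitely many indices.
  obtain ⟨i, hi⟩ := hp q (ρ / 2) (by linarith)
    (Metric.ball_subset_ball' (by linarith [Metric.mem_closedBall.1 hq]))
  refine ⟨Metric.ball q (ρ / 2), mem_nhdsWithin_of_mem_nhds (Metric.ball_mem_nhds _ (by linarith)),
    ?_⟩
  filter_upwards [eventually_gt_atTop i] with n hn q' hq'
  refine ⟨⟨i, hn⟩, ?_⟩
  calc dist (p i) q' ≤ dist (p i) q + dist q' q := dist_triangle_right _ _ _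
    _ < ρ := by linarith [Metric.mem_ball.1 hi, Metric.mem_ball.1 hq']

theorem tendsto_sum_delaunayWeight {p : ℕ → EuclideanSpace ℝ (Fin d)} {δ : ℝ} (hδ : 0 < δ)
    (hp : ∀ q r, 0 < r → Metric.ball q r ⊆ Metric.ball z δ → ∃ i, p i ∈ Metric.ball q r)
    (hw : ∀ᶠ n in atTop, z ∈ convexHull ℝ (range fun i : Fin n => p i) →
      ∃ w, IsDelaunayWeight (fun i : Fin n => p i) z w)
    {K : Set (EuclideanSpace ℝ (Fin d))} (hpK : ∀ i, p i ∈ K)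
    {g : EuclideanSpace ℝ (Fin d) → ℝ} (hg : ContinuousWithinAt g K z) :
    Tendsto (fun n => ∑ i, delaunayWeight (fun i : Fin n => p i) z i * g (p i)) atTop
      (𝓝 (g z)) := by
  rw [Metric.tendsto_nhds]
  intro ε hε
  obtain ⟨τ, hτ, hgτ⟩ := Metric.continuousWithinAt_iff.1 hg (ε / 2) (by linarith)
  -- Vertices are within `2 * ρ` of `z`: `2 * ρ ≤ δ` keeps the balls in the filled region, `2 * ρ ≤
  -- τ` controls `g`.
  set ρ := min (δ / 2) (τ / 2)
  have hρ : 0 < ρ := by positivity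
  filter_upwards [hw, eventually_fill hρ (by linarith [min_le_left (δ / 2) (τ / 2)]) hp]
    with n hwn hfill
  have hex := hwn (mem_convexHull_of_fill hρ hfill)
  have hD : IsDelaunayWeight (fun i : Fin n => p i) z (delaunayWeight (fun i : Fin n => p i) z) :=
    isDelaunayWeight_or_eq_zero.resolve_right fun h => h.1 hex
  set W := delaunayWeight (fun i : Fin n => p i) z
  have hsum : ∑ i, W i * g (p i) - g z = ∑ i, W i * (g (p i) - g z) := by
    simp [mul_sub, Finset.sum_sub_distrib, ← Finset.sum_mul, hD.1.2]
  rw [Real.dist_eq, hsum]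
  calc |∑ i, W i * (g (p i) - g z)| ≤ ∑ i, |W i * (g (p i) - g z)| :=
        Finset.abs_sum_le_sum_abs _ _
    _ ≤ ∑ i, W i * (ε / 2) := by
        refine Finset.sum_le_sum fun i _ => ?_
        by_cases hi : W i = 0
        · simp [hi]
        · rw [abs_mul, abs_of_nonneg (hD.1.1 i)]
          refine mul_le_mul_of_nonneg_left ?_ (hD.1.1 i)
          rw [← Real.dist_eq]
          exact (hgτ (hpK i) ((hD.dist_lt hρ hfill hi).trans_le
            (by linarith [min_le_right (δ / 2) (τ / 2)]))).le
    _ < ε := by rw [← Finset.sum_mul, hD.1.2]; linarith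

end SimplicialInterpolation

/-! ### Almost sure general position and measurability of the weights -/

namespace SimplicialInterpolation

open Topology

variable {d n : ℕ} {x : Fin n → EuclideanSpace ℝ (Fin d)} {z : EuclideanSpace ℝ (Fin d)}
  {w : Fin n → ℝ}

/-- Replacing one coordinate by an independent copy preserves a product measure. -/
theorem measurePreserving_update {ι α : Type*} [Fintype ι] [DecidableEq ι] [MeasurableSpace α]
    (ν : Measure α) [IsProbabilityMeasure ν] (i : ι) :
    MeasurePreserving (fun q : (ι → α) × α => Function.update q.1 i q.2)
      ((Measure.pi fun _ => ν).prod ν) (Measure.pi fun _ => ν) := by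
  have hm : Measurable fun q : (ι → α) × α => Function.update q.1 i q.2 := by
    refine measurable_pi_iff.2 fun j => ?_
    by_cases h : j = i
    · subst h; simpa using measurable_snd
    · simp only [Function.update_of_ne h]
      fun_prop
  refine ⟨hm, (Measure.pi_eq fun s hs => ?_).symm⟩
  rw [Measure.map_apply hm (MeasurableSet.univ_pi hs)]
  have : (fun q : (ι → α) × α => Function.update q.1 i q.2) ⁻¹' univ.pi s =
      (univ.pi (Function.update s i univ)) ×ˢ s i := by
    ext q
    simp only [mem_preimage, mem_univ_pi, mem_prod]
    constructor
    · refine fun h => ⟨fun j => ?_, by simpa using h i⟩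
      by_cases hj : j = i
      · subst hj; simp
      · simpa [hj] using h j
    · rintro ⟨h, h'⟩ j
      by_cases hj : j = i
      · subst hj; simpa using h'
      · simpa [hj] using h j
  rw [this, Measure.prod_prod, Measure.pi_pi,
    ← Finset.mul_prod_erase _ _ (Finset.mem_univ i),
    ← Finset.mul_prod_erase _ (fun j => ν (s j)) (Finset.mem_univ i), Function.update_self,
    measure_univ, one_mul, mul_comm]
  congr 1
  exact Finset.prod_congr rfl fun j hj => by rw [Function.update_of_ne (Finset.ne_of_mem_erase hj)]

theorem measure_pi_null_of_update {ι α : Type*} [Fintype ι] [DecidableEq ι] [MeasurableSpace α]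
    (ν : Measure α) [IsProbabilityMeasure ν] (i : ι) {S : Set (ι → α)} (hS : MeasurableSet S)
    (h : ∀ p, ν {a | Function.update p i a ∈ S} = 0) : Measure.pi (fun _ => ν) S = 0 := by
  have hp := measurePreserving_update ν i
  rw [← hp.measure_preimage hS.nullMeasurableSet, Measure.measure_prod_null (hp.measurable hS)]
  exact Eventually.of_forall h

/-- A closed subset of the product is σ-compact, and so is its projection. This is how existential
conditions on spheres and weights become Borel. -/
theorem measurableSet_exists_of_isClosed {α β : Type*} [TopologicalSpace α] [T2Space α]
    [MeasurableSpace α] [BorelSpace α] [SigmaCompactSpace α] [TopologicalSpace β]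
    [SigmaCompactSpace β] {S : Set (α × β)} (hS : IsClosed S) :
    MeasurableSet {a | ∃ b, (a, b) ∈ S} := by
  have h : {a | ∃ b, (a, b) ∈ S} = Prod.fst '' S := by
    ext a; simp
  rw [h]
  obtain ⟨k, hk, hkS⟩ :=
    (isSigmaCompact_univ.of_isClosed_subset hS (subset_univ _)).image continuous_fst
  rw [← hkS]
  exact MeasurableSet.iUnion fun i => (hk i).measurableSet

theorem affineSpan_image_ne_top (s : Finset (Fin n)) (hs : s.card ≤ d) (hd : 1 ≤ d) :
    affineSpan ℝ (x '' (s : Set (Fin n))) ≠ ⊤ := by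
  classical
  intro h
  have h1 : Module.finrank ℝ (vectorSpan ℝ (x '' (s : Set (Fin n)))) = d := by
    rw [← direction_affineSpan, h, AffineSubspace.direction_top, finrank_top]
    simp
  rcases Nat.eq_zero_or_pos s.card with h0 | h0
  · rw [Finset.card_eq_zero] at h0
    rw [h0, Finset.coe_empty, image_empty, vectorSpan_empty, finrank_bot] at h1
    omega
  · have := finrank_vectorSpan_image_finset_le ℝ x s (n := s.card - 1) (by omega)
    rw [Finset.coe_image] at this
    omega

/-- With the other points fixed, point `i` would have to fall into a proper affine subspace, a null
set. -/
theorem ae_notMem_affineSpan (hd : 1 ≤ d) (μ : Measure (EuclideanSpace ℝ (Fin d)))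
    [IsProbabilityMeasure μ] (hμ : μ ≪ volume) (s : Finset (Fin n)) (hs : s.card ≤ d)
    (i : Fin n) (hi : i ∉ s) :
    ∀ᵐ x ∂Measure.pi (fun _ : Fin n => μ), ¬ ∃ w : Fin n → ℝ,
      ((∀ k ∉ s, w k = 0) ∧ ∑ k, w k = 1) ∧ ∑ k, w k • x k = x i := by
  rw [ae_iff]
  simp only [not_not]
  refine measure_pi_null_of_update μ i ?_ fun p => ?_
  · refine measurableSet_exists_of_isClosed (S := {q : (Fin n → EuclideanSpace ℝ (Fin d)) ×
      (Fin n → ℝ) | ((∀ k ∉ s, q.2 k = 0) ∧ ∑ k, q.2 k = 1) ∧ ∑ k, q.2 k • q.1 k = q.1 i}) ?_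
    simp only [Set.ofPred_and, Set.ofPred_forall]
    refine (IsClosed.inter ?_ (isClosed_eq (by fun_prop) (by fun_prop))).inter
      (isClosed_eq (by fun_prop) (by fun_prop))
    exact isClosed_iInter fun k => isClosed_iInter fun _ => isClosed_eq (by fun_prop) (by fun_prop)
  · refine measure_mono_null ?_ (hμ (Measure.addHaar_affineSubspace volume _
      (affineSpan_image_ne_top (x := p) s hs hd)))
    rintro a ⟨w, ⟨hw0, hw1⟩, hw⟩
    rw [Function.update_self] at hw
    rw [SetLike.mem_coe, ← hw]
    have e1 : ∑ k ∈ s, w k = 1 := by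
      rw [← hw1]
      exact Finset.sum_subset (Finset.subset_univ _) fun k _ hk => hw0 k hk
    have e2 : ∑ k, w k • Function.update p i a k = ∑ k ∈ s, w k • p k := by
      rw [← Finset.sum_subset (Finset.subset_univ s) fun k _ hk => by simp [hw0 k hk]]
      refine Finset.sum_congr rfl fun k hk => ?_
      rw [Function.update_of_ne]
      rintro rfl
      exact hi hk
    rw [e2, ← Finset.affineCombination_eq_linear_combination s p w e1]
    exact affineCombination_mem_affineSpan_image e1 (fun _ _ h => absurd ‹_› h) p

/-- A dependence with nonzero coefficient at `i`, solved for `x i`, puts it in the affine span of at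
most `d` other points. -/
theorem affineIndependent_of_notMem_affineSpan
    (h : ∀ s : Finset (Fin n), s.card ≤ d → ∀ i ∉ s, ¬ ∃ w : Fin n → ℝ,
      ((∀ k ∉ s, w k = 0) ∧ ∑ k, w k = 1) ∧ ∑ k, w k • x k = x i)
    (s : Finset (Fin n)) (hs : s.card ≤ d + 1) : AffineIndependent ℝ (fun i : s => x i) := by
  classical
  rw [affineIndependent_iff]
  intro t u hu0 hux i hi
  by_contra hne
  let u' : Fin n → ℝ := fun k => if h : k ∈ s then (if ⟨k, h⟩ ∈ t then u ⟨k, h⟩ else 0) else 0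
  have hoff : ∀ k ∉ s, u' k = 0 := fun k hk => by simp [u', hk]
  have hon : ∀ k : s, u' k = if k ∈ t then u k else 0 := fun k => by simp [u']
  have hu'0 : ∑ k, u' k = 0 := by
    rw [← Finset.sum_subset (Finset.subset_univ s) fun k _ hk => hoff k hk,
      ← Finset.sum_coe_sort s u', ← hu0]
    simp only [hon, Finset.univ_eq_attach, Finset.sum_ite_mem]
    exact Finset.sum_congr (by ext; simp) fun _ _ => rfl
  have hu'x : ∑ k, u' k • x k = 0 := by
    rw [← Finset.sum_subset (Finset.subset_univ s) fun k _ hk => by simp [hoff k hk],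
      ← Finset.sum_coe_sort s fun k => u' k • x k, ← hux]
    simp only [hon, ite_smul, zero_smul, Finset.univ_eq_attach, Finset.sum_ite_mem]
    exact Finset.sum_congr (by ext; simp) fun _ _ => rfl
  have hui : u' i ≠ 0 := by rwa [hon, if_pos hi]
  have hcard : (s.erase i).card ≤ d := by
    rw [Finset.card_erase_of_mem i.2]; omega
  refine h (s.erase i) hcard i (Finset.notMem_erase _ _)
    ⟨fun k => (if k = i then 1 else 0) - (u' i)⁻¹ * u' k, ⟨fun k hk => ?_, ?_⟩, ?_⟩
  · by_cases hki : k = i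
    · simp [hki, hui]
    · simp [hki, hoff k fun hks => hk (Finset.mem_erase.2 ⟨hki, hks⟩)]
  · simp [Finset.sum_sub_distrib, ← Finset.mul_sum, hu'0]
  · simp [sub_smul, Finset.sum_sub_distrib, mul_smul, ← Finset.smul_sum, hu'x, ite_smul]

theorem ae_not_cospherical (hd : 1 ≤ d) (μ : Measure (EuclideanSpace ℝ (Fin d)))
    [IsProbabilityMeasure μ] (hμ : μ ≪ volume) (s : Finset (Fin n)) (hs : s.card = d + 1)
    (j : Fin n) (hj : j ∉ s) :
    ∀ᵐ x ∂Measure.pi (fun _ : Fin n => μ), ¬ (AffineIndependent ℝ (fun i : s => x i) ∧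
      ∃ q : EuclideanSpace ℝ (Fin d) × ℝ, (∀ i ∈ s, dist (x i) q.1 = q.2) ∧
        dist (x j) q.1 = q.2) := by
  rw [ae_iff]
  simp only [not_not]
  refine measure_pi_null_of_update μ j ?_ fun p => ?_
  · refine MeasurableSet.inter ?_ ?_
    · exact (isOpen_setOfPred_affineIndependent.preimage
        (f := fun (x : Fin n → EuclideanSpace ℝ (Fin d)) (i : s) => x i) (by fun_prop)).measurableSet
    · refine measurableSet_exists_of_isClosed (S := {q : (Fin n → EuclideanSpace ℝ (Fin d)) ×
        (EuclideanSpace ℝ (Fin d) × ℝ) | (∀ i ∈ s, dist (q.1 i) q.2.1 = q.2.2) ∧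
          dist (q.1 j) q.2.1 = q.2.2}) ?_
      simp only [Set.ofPred_and, Set.ofPred_forall]
      refine IsClosed.inter ?_ (isClosed_eq (by fun_prop) (by fun_prop))
      exact isClosed_iInter fun k => isClosed_iInter fun _ =>
        isClosed_eq (by fun_prop) (by fun_prop)
  -- The other points are fixed. One admissible position `a₀` supplies a sphere through the `d + 1`
  -- vertices; any other position lies on the same sphere, since the difference of the two powers is
  -- affine and vanishes on an affinely spanning set.
  · rcases eq_empty_or_nonempty {a | Function.update p j a ∈ {x | AffineIndependent ℝ
      (fun i : s => x i) ∧ ∃ q : EuclideanSpace ℝ (Fin d) × ℝ, (∀ i ∈ s, dist (x i) q.1 = q.2) ∧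
        dist (x j) q.1 = q.2}} with h0 | ⟨a₀, hind, ⟨c₀, r₀⟩, hs₀, hj₀⟩
    · rw [h0]; exact measure_empty
    have hupd : ∀ a, ∀ i ∈ s, Function.update p j a i = p i := fun a i hi =>
      Function.update_of_ne (by rintro rfl; exact hj hi) _ _
    have hind' : AffineIndependent ℝ (fun i : s => p i) := by
      convert hind using 2 with i
      exact (hupd a₀ i i.2).symm
    have htop : affineSpan ℝ (range fun i : s => p i) = ⊤ := by
      rw [hind'.affineSpan_eq_top_iff_card_eq_finrank_add_one]
      simp [hs]
    have : Nonempty (Fin d) := ⟨⟨0, hd⟩⟩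
    refine measure_mono_null (t := Metric.sphere c₀ r₀) ?_
      (hμ (Measure.addHaar_sphere volume c₀ r₀))
    rintro a ⟨-, ⟨c, r⟩, hsa, hja⟩
    rw [Function.update_self] at hja
    dsimp only at hsa hja hs₀ hj₀
    have ha : a ∈ affineSpan ℝ (range fun i : s => p i) := htop ▸ AffineSubspace.mem_top _ _ _
    obtain ⟨w, hw1, hwa⟩ := eq_affineCombination_of_mem_affineSpan_of_fintype ha
    rw [Finset.affineCombination_eq_linear_combination _ _ _ hw1] at hwa
    have key := sum_mul_power_sub_power (c := c) (c' := c₀) (r := r) (r' := r₀) hw1 hwa.symm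
    have hz : ∀ i : s, w i * ((dist (p i) c ^ 2 - r ^ 2) - (dist (p i) c₀ ^ 2 - r₀ ^ 2)) = 0 := by
      intro i
      rw [← hsa i i.2, ← hs₀ i i.2, hupd a i i.2, hupd a₀ i i.2]
      ring
    rw [Finset.sum_congr rfl fun i _ => hz i, Finset.sum_const_zero, hja] at key
    have hr₀ : 0 ≤ r₀ := hj₀ ▸ dist_nonneg
    exact (pow_left_inj₀ dist_nonneg hr₀ two_ne_zero).1 (by linarith)

theorem ae_generalPosition (hd : 1 ≤ d) (μ : Measure (EuclideanSpace ℝ (Fin d)))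
    [IsProbabilityMeasure μ] (hμ : μ ≪ volume) :
    ∀ᵐ x ∂Measure.pi (fun _ : Fin n => μ), GeneralPosition x := by
  have h1 : ∀ᵐ x ∂Measure.pi (fun _ : Fin n => μ), ∀ s : Finset (Fin n), s.card ≤ d → ∀ i ∉ s,
      ¬ ∃ w : Fin n → ℝ, ((∀ k ∉ s, w k = 0) ∧ ∑ k, w k = 1) ∧ ∑ k, w k • x k = x i := by
    simp only [ae_all_iff]
    exact fun s hs i hi => ae_notMem_affineSpan hd μ hμ s hs i hi
  have h2 : ∀ᵐ x ∂Measure.pi (fun _ : Fin n => μ), ∀ s : Finset (Fin n), s.card = d + 1 →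
      ∀ j ∉ s, ¬ (AffineIndependent ℝ (fun i : s => x i) ∧
      ∃ q : EuclideanSpace ℝ (Fin d) × ℝ, (∀ i ∈ s, dist (x i) q.1 = q.2) ∧
        dist (x j) q.1 = q.2) := by
    simp only [ae_all_iff]
    exact fun s hs i hi => ae_not_cospherical hd μ hμ s hs i hi
  filter_upwards [h1, h2] with x h1 h2
  have hind := affineIndependent_of_notMem_affineSpan h1
  refine ⟨hind, fun c r s hs => ?_⟩
  by_contra! hcard
  obtain ⟨t, hts, ht⟩ := Finset.exists_subset_card_eq hcard.le
  obtain ⟨j, hj, hjt⟩ := Finset.exists_mem_notMem_of_card_lt_card (ht ▸ hcard)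
  exact h2 t ht j hjt ⟨hind t ht.le, (c, r), fun i hi => hs i (hts hi), hs j hj⟩

theorem GeneralPosition.affineSpan_eq_top (hx : GeneralPosition x) (hn : d < n) :
    affineSpan ℝ (range x) = ⊤ := by
  obtain ⟨s, -, hs⟩ := Finset.exists_subset_card_eq (s := (Finset.univ : Finset (Fin n)))
    (n := d + 1) (by simpa using hn)
  have htop : affineSpan ℝ (range fun i : s => x i) = ⊤ := by
    rw [(hx.affineIndependent s hs.le).affineSpan_eq_top_iff_card_eq_finrank_add_one]
    simp [hs]
  exact top_le_iff.1 (htop ▸ affineSpan_mono ℝ (range_comp_subset_range _ x))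

theorem measurableSet_exists_weight (C : Set (Fin n → ℝ)) (hC : IsClosed C) :
    MeasurableSet {q : (Fin n → EuclideanSpace ℝ (Fin d)) × EuclideanSpace ℝ (Fin d) |
      ∃ w, IsDelaunayWeight q.1 q.2 w ∧ w ∈ C} := by
  -- The support condition is written as a vanishing product, which is closed.
  have h := measurableSet_exists_of_isClosed
    (α := (Fin n → EuclideanSpace ℝ (Fin d)) × EuclideanSpace ℝ (Fin d))
    (β := (Fin n → ℝ) × EuclideanSpace ℝ (Fin d) × ℝ)
    (S := {q | q.2.1 ∈ C ∩ stdSimplex ℝ (Fin n) ∧ (∑ i, q.2.1 i • q.1.1 i = q.1.2) ∧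
      (∀ j, q.2.2.2 ≤ dist (q.1.1 j) q.2.2.1) ∧
      ∀ i, q.2.1 i * (dist (q.1.1 i) q.2.2.1 - q.2.2.2) = 0}) ?_
  · convert h using 3 with q
    constructor
    · rintro ⟨w, ⟨hs, hz, c, r, hcr, hc⟩, hw⟩
      refine ⟨(w, c, r), ⟨hw, hs⟩, hz, hcr, fun i => ?_⟩
      by_cases hi : w i = 0
      · simp [hi]
      · simp [hc i hi]
    · rintro ⟨⟨w, c, r⟩, ⟨hw, hs⟩, hz, hcr, hc⟩
      exact ⟨w, ⟨hs, hz, c, r, hcr, fun i hi =>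
        sub_eq_zero.1 ((mul_eq_zero.1 (hc i)).resolve_left hi)⟩, hw⟩
  · simp only [Set.ofPred_and, Set.ofPred_forall]
    refine (IsClosed.preimage (by fun_prop) (hC.inter (isClosed_stdSimplex _ _))).inter
      ((isClosed_eq (by fun_prop) (by fun_prop)).inter (IsClosed.inter ?_ ?_))
    · exact isClosed_iInter fun j => isClosed_le (by fun_prop) (by fun_prop)
    · exact isClosed_iInter fun j => isClosed_eq (by fun_prop) (by fun_prop)

theorem measurable_indicator_delaunayWeight {G : Set (Fin n → EuclideanSpace ℝ (Fin d))}
    (hG : MeasurableSet G) (hGP : ∀ x ∈ G, GeneralPosition x) :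
    Measurable ((G ×ˢ univ).indicator
      fun q : (Fin n → EuclideanSpace ℝ (Fin d)) × EuclideanSpace ℝ (Fin d) =>
        delaunayWeight q.1 q.2) := by
  refine measurable_of_isClosed fun C hC => ?_
  have hGu : MeasurableSet (G ×ˢ (univ : Set (EuclideanSpace ℝ (Fin d)))) :=
    hG.prod MeasurableSet.univ
  have h1 := measurableSet_exists_weight (d := d) C hC
  have h2 := measurableSet_exists_weight (n := n) (d := d) univ isClosed_univ
  -- On `G` uniqueness turns a condition on the chosen weight into existence of a weight in `C`; the
  -- second set collects the pairs where the value is zero by default.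
  convert (hGu.inter h1).union ((hGu.inter h2).compl.inter
    (MeasurableSet.const ((0 : Fin n → ℝ) ∈ C))) using 1
  ext q
  simp only [mem_preimage, mem_union, mem_inter_iff, mem_compl_iff, mem_prod, mem_univ, and_true,
    mem_ofPred_eq]
  by_cases hq : q.1 ∈ G
  · rw [indicator_of_mem (by simpa using hq)]
    rcases isDelaunayWeight_or_eq_zero (x := q.1) (z := q.2) with h | h
    · have : ∀ w, IsDelaunayWeight q.1 q.2 w ↔ w = delaunayWeight q.1 q.2 := fun w =>
        ⟨fun hw => ((hGP _ hq).delaunayWeight_eq hw).symm, fun hw => hw ▸ h⟩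
      simp [hq, this]
    · rw [h.2]
      have h' : ∀ w, ¬ IsDelaunayWeight q.1 q.2 w := fun w hw => h.1 ⟨w, hw⟩
      simp [h']
  · rw [indicator_of_notMem (by simpa using hq)]
    simp [hq]

end SimplicialInterpolation

namespace SimplicialInterpolation

open Topology

/-! ### The noise term -/

theorem integral_pi_eq_zero_of_update {ι α : Type*} [Fintype ι] [DecidableEq ι]
    [MeasurableSpace α] (ν : Measure α) [IsProbabilityMeasure ν] (i : ι) {f : (ι → α) → ℝ}
    (hf : Integrable f (Measure.pi fun _ => ν))
    (h : ∀ p, ∫ a, f (Function.update p i a) ∂ν = 0) : ∫ p, f p ∂Measure.pi (fun _ => ν) = 0 := by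
  have hp := measurePreserving_update ν i
  have hint := (hp.integrable_comp hf.aestronglyMeasurable).2 hf
  rw [← hp.map_eq, integral_map hp.measurable.aemeasurable (by rw [hp.map_eq]; exact hf.1)]
  exact (integral_prod _ hint).trans (by simp [h])

/-- The noise terms of distinct examples are uncorrelated given the unlabeled points. -/
theorem integral_sq_sum_noise {n : ℕ} {β : Type*} [MeasurableSpace β] (ν : Measure (β × ℝ))
    [IsProbabilityMeasure ν] {η v : β → ℝ} (hη : Measurable η) (hv : Measurable v)
    (hbd : ∀ᵐ a ∂ν, |a.2 - η a.1| ≤ 1) (hvbd : ∀ᵐ a ∂ν, |v a.1| ≤ 1)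
    (hmean : ∀ h : β → ℝ, Measurable h → (∃ C, ∀ b, |h b| ≤ C) →
      ∫ a, (a.2 - η a.1) * h a.1 ∂ν = 0)
    (hvar : ∀ h : β → ℝ, Measurable h → (∃ C, ∀ b, |h b| ≤ C) →
      ∫ a, ((a.2 - η a.1) ^ 2 - v a.1) * h a.1 ∂ν = 0)
    {W : (Fin n → β) → Fin n → ℝ} (hW : Measurable W) (hW0 : ∀ x i, 0 ≤ W x i)
    (hW1 : ∀ x i, W x i ≤ 1) :
    ∫ p, (∑ i, W (fun k => (p k).1) i * ((p i).2 - η (p i).1)) ^ 2 ∂Measure.pi (fun _ => ν) =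
      ∑ i, ∫ p, W (fun k => (p k).1) i ^ 2 * v (p i).1 ∂Measure.pi (fun _ => ν) := by
  have hfst : Measurable fun p : Fin n → β × ℝ => fun k => (p k).1 := by fun_prop
  have hWm : ∀ i, Measurable fun p : Fin n → β × ℝ => W (fun k => (p k).1) i := fun i =>
    (measurable_pi_apply i).comp (hW.comp hfst)
  have habs : ∀ x i, |W x i| ≤ 1 := fun x i => by rw [abs_of_nonneg (hW0 x i)]; exact hW1 x i
  have hbdi : ∀ i : Fin n, ∀ᵐ p ∂Measure.pi (fun _ : Fin n => ν), |(p i).2 - η (p i).1| ≤ 1 :=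
    fun i => (measurePreserving_eval (fun _ : Fin n => ν) i).quasiMeasurePreserving.ae hbd
  have hvbdi : ∀ i : Fin n, ∀ᵐ p ∂Measure.pi (fun _ : Fin n => ν), |v (p i).1| ≤ 1 :=
    fun i => (measurePreserving_eval (fun _ : Fin n => ν) i).quasiMeasurePreserving.ae hvbd
  have hupd : ∀ (p : Fin n → β × ℝ) i a, (fun k => (Function.update p i a k).1) =
      Function.update (fun k => (p k).1) i a.1 := fun p i a => by
    ext k
    by_cases hk : k = i
    · subst hk; simp
    · simp [hk]
  have hupdm : ∀ (x : Fin n → β) i, Measurable fun b => Function.update x i b := fun x i =>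
    measurable_update x
  have hint : ∀ i j, Integrable (fun p : Fin n → β × ℝ =>
      (W (fun k => (p k).1) i * ((p i).2 - η (p i).1)) *
        (W (fun k => (p k).1) j * ((p j).2 - η (p j).1))) (Measure.pi fun _ => ν) := by
    intro i j
    refine Integrable.of_bound (C := 1) ?_ ?_
    · exact (((hWm i).mul (by fun_prop)).mul ((hWm j).mul (by fun_prop))).aestronglyMeasurable
    · filter_upwards [hbdi i, hbdi j] with p hi hj
      rw [Real.norm_eq_abs, abs_mul, abs_mul, abs_mul]
      exact mul_le_one₀ (mul_le_one₀ (habs _ _) (abs_nonneg _) hi) (by positivity)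
        (mul_le_one₀ (habs _ _) (abs_nonneg _) hj)
  have hintv : ∀ i, Integrable (fun p : Fin n → β × ℝ =>
      W (fun k => (p k).1) i ^ 2 * v (p i).1) (Measure.pi fun _ => ν) := by
    intro i
    refine Integrable.of_bound (C := 1) ?_ ?_
    · exact (((hWm i).pow_const 2).mul (by fun_prop)).aestronglyMeasurable
    · filter_upwards [hvbdi i] with p hi
      rw [Real.norm_eq_abs, abs_mul, abs_pow]
      exact mul_le_one₀ (pow_le_one₀ (abs_nonneg _) (habs _ _)) (abs_nonneg _) hi
  have hoff : ∀ i j, i ≠ j → ∫ p : Fin n → β × ℝ,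
      (W (fun k => (p k).1) i * ((p i).2 - η (p i).1)) *
        (W (fun k => (p k).1) j * ((p j).2 - η (p j).1)) ∂(Measure.pi fun _ => ν) = 0 := by
    intro i j hij
    -- Resampling example `i` leaves the noise of `j` constant, and the weights depend on the new
    -- example only through its unlabeled point, so `hmean` applies.
    refine integral_pi_eq_zero_of_update ν i (hint i j) fun p => ?_
    rw [← hmean (fun b => W (Function.update (fun k => (p k).1) i b) i *
      (W (Function.update (fun k => (p k).1) i b) j * ((p j).2 - η (p j).1)))]
    · refine integral_congr_ae (Eventually.of_forall fun a => ?_)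
      simp only [hupd, Function.update_self, Function.update_of_ne hij.symm]
      ring
    · have := hW.comp (hupdm (fun k => (p k).1) i)
      exact ((measurable_pi_apply i).comp this).mul
        (((measurable_pi_apply j).comp this).mul_const _)
    · refine ⟨|(p j).2 - η (p j).1|, fun b => ?_⟩
      rw [abs_mul, abs_mul, ← mul_assoc]
      exact mul_le_of_le_one_left (abs_nonneg _)
        (mul_le_one₀ (habs _ _) (abs_nonneg _) (habs _ _))
  have hdiag : ∀ i, ∫ p : Fin n → β × ℝ,
      (W (fun k => (p k).1) i * ((p i).2 - η (p i).1)) *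
        (W (fun k => (p k).1) i * ((p i).2 - η (p i).1)) ∂(Measure.pi fun _ => ν) =
      ∫ p, W (fun k => (p k).1) i ^ 2 * v (p i).1 ∂Measure.pi (fun _ => ν) := by
    intro i
    rw [← sub_eq_zero, ← integral_sub (hint i i) (hintv i)]
    refine integral_pi_eq_zero_of_update ν i ((hint i i).sub (hintv i)) fun p => ?_
    rw [← hvar (fun b => W (Function.update (fun k => (p k).1) i b) i ^ 2)]
    · refine integral_congr_ae (Eventually.of_forall fun a => ?_)
      simp only [hupd, Function.update_self]
      ring
    · exact ((measurable_pi_apply i).comp (hW.comp (hupdm (fun k => (p k).1) i))).pow_const 2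
    · exact ⟨1, fun b => by rw [abs_pow]; exact pow_le_one₀ (abs_nonneg _) (habs _ _)⟩
  simp only [sq (∑ i, _), Finset.sum_mul_sum]
  rw [integral_finsetSum _ fun i _ => integrable_finsetSum _ fun j _ => hint i j]
  refine Finset.sum_congr rfl fun i _ => ?_
  rw [integral_finsetSum _ fun j _ => hint i j, ← hdiag i]
  exact Finset.sum_eq_single i (fun j _ hji => hoff i j hji.symm) (by simp)

variable {d n : ℕ}

/-- Weights vanish off the hull of the points, hence off the convex set `K`, so the identity over
the whole space passes to the uniform law. -/
theorem GeneralPosition.integral_sq_delaunayWeight_cond {x : Fin n → EuclideanSpace ℝ (Fin d)}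
    (hx : GeneralPosition x) {K : Set (EuclideanSpace ℝ (Fin d))} (hK : Convex ℝ K)
    (hxK : ∀ i, x i ∈ K) (i : Fin n) (hm : Measurable fun z => delaunayWeight x z i) :
    ∫ z, delaunayWeight x z i ^ 2 ∂(ProbabilityTheory.cond volume K) =
      2 / (d + 2) * ∫ z, delaunayWeight x z i ∂(ProbabilityTheory.cond volume K) := by
  have hoff : ∀ z ∉ K, delaunayWeight x z i = 0 := by
    intro z hz
    rcases isDelaunayWeight_or_eq_zero (x := x) (z := z) with h | h
    · exact absurd (convexHull_min (range_subset_iff.2 hxK) hK h.mem_convexHull) hz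
    · simp [h.2]
  rw [ProbabilityTheory.cond, integral_smul_measure, integral_smul_measure,
    setIntegral_eq_integral_of_forall_compl_eq_zero (fun z hz => by simp [hoff z hz]),
    setIntegral_eq_integral_of_forall_compl_eq_zero hoff,
    integral_eq_lintegral_of_nonneg_ae (Eventually.of_forall fun z => sq_nonneg _)
      (hm.pow_const 2).aestronglyMeasurable,
    integral_eq_lintegral_of_nonneg_ae (Eventually.of_forall fun z => delaunayWeight_nonneg i)
      hm.aestronglyMeasurable, hx.lintegral_sq_delaunayWeight i hm.aemeasurable,
    ENNReal.toReal_mul, ENNReal.toReal_ofReal (by positivity)]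
  simp only [smul_eq_mul]
  ring

/-- The variance of the interpolated noise. -/
theorem integral_sq_sum_noise_delaunayWeight (ν : Measure (EuclideanSpace ℝ (Fin d) × ℝ))
    [IsProbabilityMeasure ν] {K : Set (EuclideanSpace ℝ (Fin d))} (hK : Convex ℝ K)
    [IsProbabilityMeasure (ProbabilityTheory.cond volume K)]
    (hνK : ∀ᵐ a ∂ν, a.1 ∈ K)
    {η v : EuclideanSpace ℝ (Fin d) → ℝ} (hη : Measurable η) (hv : Measurable v)
    (hbd : ∀ᵐ a ∂ν, |a.2 - η a.1| ≤ 1) (hvbd : ∀ᵐ a ∂ν, |v a.1| ≤ 1)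
    (hmean : ∀ h : EuclideanSpace ℝ (Fin d) → ℝ, Measurable h → (∃ C, ∀ b, |h b| ≤ C) →
      ∫ a, (a.2 - η a.1) * h a.1 ∂ν = 0)
    (hvar : ∀ h : EuclideanSpace ℝ (Fin d) → ℝ, Measurable h → (∃ C, ∀ b, |h b| ≤ C) →
      ∫ a, ((a.2 - η a.1) ^ 2 - v a.1) * h a.1 ∂ν = 0)
    {G : Set (Fin n → EuclideanSpace ℝ (Fin d))} (hG : MeasurableSet G)
    (hGP : ∀ x ∈ G, GeneralPosition x)
    {W : (Fin n → EuclideanSpace ℝ (Fin d)) × EuclideanSpace ℝ (Fin d) → Fin n → ℝ}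
    (hW : W = (G ×ˢ univ).indicator fun q => delaunayWeight q.1 q.2) :
    ∫ q, (∑ i, W (fun k => (q.1 k).1, q.2) i * ((q.1 i).2 - η (q.1 i).1)) ^ 2
        ∂((Measure.pi fun _ => ν).prod (ProbabilityTheory.cond volume K)) =
      2 / (d + 2) * ∫ q, ∑ i, W (fun k => (q.1 k).1, q.2) i * v (q.1 i).1
        ∂((Measure.pi fun _ => ν).prod (ProbabilityTheory.cond volume K)) := by
  set μ := ProbabilityTheory.cond volume K
  have hWm : Measurable W := hW ▸ measurable_indicator_delaunayWeight hG hGP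
  have hW0 : ∀ q i, 0 ≤ W q i := fun q i => by
    rw [hW]
    by_cases h : q ∈ G ×ˢ univ
    · rw [indicator_of_mem h]; exact delaunayWeight_nonneg i
    · rw [indicator_of_notMem h]; exact le_rfl
  have hW1 : ∀ q i, W q i ≤ 1 := fun q i => by
    rw [hW]
    by_cases h : q ∈ G ×ˢ univ
    · rw [indicator_of_mem h]; exact delaunayWeight_le_one i
    · rw [indicator_of_notMem h]; exact zero_le_one
  have habs : ∀ q i, |W q i| ≤ 1 := fun q i => by rw [abs_of_nonneg (hW0 q i)]; exact hW1 q i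
  have hWim : ∀ i, Measurable fun q : (Fin n → EuclideanSpace ℝ (Fin d) × ℝ) ×
      EuclideanSpace ℝ (Fin d) => W (fun k => (q.1 k).1, q.2) i := fun i =>
    (measurable_pi_apply i).comp (hWm.comp (by fun_prop))
  have hev : ∀ i : Fin n, Measure.QuasiMeasurePreserving
      (fun q : (Fin n → EuclideanSpace ℝ (Fin d) × ℝ) × EuclideanSpace ℝ (Fin d) => q.1 i)
      ((Measure.pi fun _ => ν).prod μ) ν := fun i =>
    ((measurePreserving_eval (fun _ : Fin n => ν) i).comp
      measurePreserving_fst).quasiMeasurePreserving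
  have hint1 : ∀ i (e : ℕ), Integrable (fun q : (Fin n → EuclideanSpace ℝ (Fin d) × ℝ) ×
      EuclideanSpace ℝ (Fin d) => W (fun k => (q.1 k).1, q.2) i ^ e * v (q.1 i).1)
      ((Measure.pi fun _ => ν).prod μ) := by
    intro i e
    refine Integrable.of_bound (C := 1) ?_ ?_
    · exact (((hWim i).pow_const e).mul (by fun_prop)).aestronglyMeasurable
    · filter_upwards [(hev i).ae hvbd] with p hi
      rw [Real.norm_eq_abs, abs_mul, abs_pow]
      exact mul_le_one₀ (pow_le_one₀ (abs_nonneg _) (habs _ _)) (abs_nonneg _) hi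
  have hintS : Integrable (fun q : (Fin n → EuclideanSpace ℝ (Fin d) × ℝ) ×
      EuclideanSpace ℝ (Fin d) =>
        (∑ i, W (fun k => (q.1 k).1, q.2) i * ((q.1 i).2 - η (q.1 i).1)) ^ 2)
      ((Measure.pi fun _ => ν).prod μ) := by
    refine Integrable.of_bound (C := (n : ℝ) ^ 2) ?_ ?_
    · exact ((Finset.measurable_fun_sum _ fun i _ =>
        (hWim i).mul (by fun_prop)).pow_const 2).aestronglyMeasurable
    · filter_upwards [ae_all_iff.2 fun i => (hev i).ae hbd] with p hp
      rw [Real.norm_eq_abs, abs_pow]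
      refine pow_le_pow_left₀ (abs_nonneg _) ((Finset.abs_sum_le_sum_abs _ _).trans ?_) 2
      refine (Finset.sum_le_card_nsmul _ _ 1 fun i _ => ?_).trans (by simp)
      rw [abs_mul]
      exact mul_le_one₀ (habs _ _) (abs_nonneg _) (hp i)
  -- For fixed `z` the data are integrated first, which removes the cross terms. Afterwards the
  -- order is reversed: for fixed data, `v` at a vertex is a constant and integrating over `z` gives
  -- the factor `2 / (d + 2)`.
  rw [integral_prod_symm _ hintS]
  have hz : ∀ z, ∫ p, (∑ i, W (fun k => (p k).1, z) i * ((p i).2 - η (p i).1)) ^ 2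
      ∂Measure.pi (fun _ => ν) =
      ∑ i, ∫ p, W (fun k => (p k).1, z) i ^ 2 * v (p i).1 ∂Measure.pi (fun _ => ν) := fun z =>
    integral_sq_sum_noise ν hη hv hbd hvbd hmean hvar (W := fun x => W (x, z))
      (hWm.comp (by fun_prop)) (fun x => hW0 _) (fun x => hW1 _)
  simp only [hz]
  rw [integral_finsetSum _ fun i _ => (hint1 i 2).integral_prod_right,
    integral_finsetSum _ fun i _ => by simpa using hint1 i 1, Finset.mul_sum]
  refine Finset.sum_congr rfl fun i _ => ?_
  rw [← integral_prod_symm _ (hint1 i 2), integral_prod _ (hint1 i 2),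
    integral_prod _ (by simpa using hint1 i 1), ← integral_const_mul]
  have hall : ∀ᵐ p ∂Measure.pi (fun _ : Fin n => ν), ∀ k, (p k).1 ∈ K := ae_all_iff.2 fun k =>
    (measurePreserving_eval (fun _ : Fin n => ν) k).quasiMeasurePreserving.ae hνK
  refine integral_congr_ae ?_
  filter_upwards [hall] with p hp
  simp only [integral_mul_const]
  by_cases hpG : (fun k => (p k).1) ∈ G
  · have hWz : ∀ z, W (fun k => (p k).1, z) i = delaunayWeight (fun k => (p k).1) z i := fun z => by
      rw [hW, indicator_of_mem (by simpa using hpG)]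
    have hm : Measurable fun z => delaunayWeight (fun k => (p k).1) z i := by
      simp only [← hWz]
      exact (measurable_pi_apply i).comp (hWm.comp (by fun_prop))
    simp only [hWz]
    rw [(hGP _ hpG).integral_sq_delaunayWeight_cond hK hp i hm]
    ring
  · have hWz : ∀ z, W (fun k => (p k).1, z) i = 0 := fun z => by
      rw [hW, indicator_of_notMem (by simpa using hpG)]; rfl
    simp [hWz]

end SimplicialInterpolation

/-! ### Conditional expectations, joint laws and density of the sample -/

namespace SimplicialInterpolation

open Topology

theorem integral_condExp_mul {Ω β : Type*} [MeasurableSpace Ω] [MeasurableSpace β] {P : Measure Ω}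
    [IsProbabilityMeasure P] {X₀ : Ω → β} (hX₀ : Measurable X₀) {f g : Ω → ℝ}
    (hf : Integrable f P)
    (hg : g =ᵐ[P] condExp (MeasurableSpace.comap X₀ inferInstance) P f) {h : β → ℝ}
    (hh : Measurable h) (hhb : ∃ C, ∀ b, |h b| ≤ C) :
    ∫ ω, (f ω - g ω) * h (X₀ ω) ∂P = 0 := by
  obtain ⟨C, hC⟩ := hhb
  have hm : MeasurableSpace.comap X₀ inferInstance ≤ (inferInstance : MeasurableSpace Ω) :=
    hX₀.comap_le
  have hgi : Integrable g P := (integrable_congr hg).2 integrable_condExp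
  have hbdd : ∀ {u : Ω → ℝ}, Integrable u P → Integrable (fun ω => u ω * h (X₀ ω)) P := fun hu =>
    hu.mul_bdd (c := C) (hh.comp hX₀).aestronglyMeasurable
      (Eventually.of_forall fun ω => hC (X₀ ω))
  have hsm : StronglyMeasurable[MeasurableSpace.comap X₀ inferInstance] (fun ω => h (X₀ ω)) :=
    (hh.comp (comap_measurable X₀)).stronglyMeasurable
  have key := condExp_mul_of_stronglyMeasurable_right hsm (hbdd hf) hf
  simp only [sub_mul]
  rw [integral_sub (hbdd hf) (hbdd hgi), sub_eq_zero, ← integral_condExp hm]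
  refine integral_congr_ae ?_
  filter_upwards [key, hg] with ω h1 h2
  rw [h2]
  exact h1

/-- An iid sequence visits, almost surely, every ball inside the convex body on which its
distribution is uniform. -/
theorem ae_exists_mem_ball {d : ℕ} {Ω : Type*} [MeasurableSpace Ω] (P : Measure Ω)
    {X : ℕ → Ω → EuclideanSpace ℝ (Fin d)} (hX : ∀ i, Measurable (X i))
    {K : Set (EuclideanSpace ℝ (Fin d))} (hKm : MeasurableSet K) (hKfin : volume K ≠ ∞)
    [IsProbabilityMeasure (ProbabilityTheory.cond volume K)]
    (hlaw : ∀ n : ℕ, P.map (fun ω (i : Fin n) => X i ω) =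
      Measure.pi fun _ => ProbabilityTheory.cond volume K) :
    ∀ᵐ ω ∂P, ∀ q r, 0 < r → Metric.ball q r ⊆ K → ∃ i, X i ω ∈ Metric.ball q r := by
  set μ := ProbabilityTheory.cond volume K with hμ
  -- A countable basis reduces the uncountable family of balls to countably many null events: `U` is
  -- missed by `n` points with probability `μ Uᶜ ^ n`.
  have hU : ∀ U ∈ TopologicalSpace.countableBasis (EuclideanSpace ℝ (Fin d)), μ U ≠ 0 →
      ∀ᵐ ω ∂P, ∃ i, X i ω ∈ U := by
    intro U hUb hU0
    have hUm : MeasurableSet U := (TopologicalSpace.isOpen_of_mem_countableBasis hUb).measurableSet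
    rw [ae_iff]
    push Not
    have hle : ∀ n : ℕ, P {ω | ∀ i, X i ω ∉ U} ≤ μ Uᶜ ^ n := by
      intro n
      have h1 : P {ω | ∀ i, X i ω ∉ U} ≤
          P ((fun ω (i : Fin n) => X i ω) ⁻¹' (univ.pi fun _ => Uᶜ)) :=
        measure_mono fun ω hω i _ => hω i
      rw [← Measure.map_apply (measurable_pi_iff.2 fun i : Fin n => hX i)
        (MeasurableSet.univ_pi fun _ => hUm.compl), hlaw n, Measure.pi_pi] at h1
      simpa using h1
    have hlt : μ Uᶜ < 1 := by
      rw [prob_compl_eq_one_sub hUm]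
      exact ENNReal.sub_lt_self ENNReal.one_ne_top one_ne_zero hU0
    exact le_antisymm (ge_of_tendsto' (ENNReal.tendsto_pow_atTop_nhds_zero_of_lt_one hlt) hle) zero_le
  have hall : ∀ᵐ ω ∂P, ∀ U ∈ TopologicalSpace.countableBasis (EuclideanSpace ℝ (Fin d)),
      μ U ≠ 0 → ∃ i, X i ω ∈ U := by
    refine (ae_ball_iff (TopologicalSpace.countable_countableBasis _)).2 fun U hUb => ?_
    by_cases h : μ U = 0
    · simp [h]
    · filter_upwards [hU U hUb h] with ω hω _ using hω
  filter_upwards [hall] with ω hω q r hr hqr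
  obtain ⟨U, hUb, hqU, hUsub⟩ := (TopologicalSpace.isBasis_countableBasis _).exists_subset_of_mem_open
    (Metric.mem_ball_self hr) Metric.isOpen_ball (a := q)
  have hU0 : μ U ≠ 0 := by
    rw [hμ, ProbabilityTheory.cond_apply hKm, inter_eq_right.2 (hUsub.trans hqr)]
    exact mul_ne_zero (ENNReal.inv_ne_zero.2 hKfin)
      ((TopologicalSpace.isOpen_of_mem_countableBasis hUb).measure_pos volume ⟨q, hqU⟩).ne'
  obtain ⟨i, hi⟩ := hω U hUb hU0
  exact ⟨i, hUsub hi⟩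

/-- The joint distribution of the training examples and the unlabeled test point. -/
theorem map_train_test {d : ℕ} {Ω : Type*} [MeasurableSpace Ω] (P : Measure Ω)
    [IsProbabilityMeasure P]
    {X : ℕ → Ω → EuclideanSpace ℝ (Fin d)} {Y : ℕ → Ω → ℝ}
    {X₀ : Ω → EuclideanSpace ℝ (Fin d)} {Y₀ : Ω → ℝ}
    (hX : ∀ i, Measurable (X i)) (hY : ∀ i, Measurable (Y i))
    (hX₀ : Measurable X₀)
    (h_ident : ∀ i, IdentDistrib (fun ω => (X i ω, Y i ω)) (fun ω => (X₀ ω, Y₀ ω)) P P)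
    (h_indep : iIndepFun (fun i ω => (X i ω, Y i ω)) P)
    (h_test : IndepFun (fun ω i => (X i ω, Y i ω)) (fun ω => (X₀ ω, Y₀ ω)) P) (n : ℕ) :
    P.map (fun ω => ((fun i : Fin n => (X i ω, Y i ω)), X₀ ω)) =
      (Measure.pi fun _ : Fin n => P.map (fun ω => (X₀ ω, Y₀ ω))).prod (P.map X₀) := by
  have h1 : iIndepFun (fun (i : Fin n) ω => (X i ω, Y i ω)) P :=
    h_indep.precomp Fin.val_injective
  have h2 : IndepFun (fun ω (i : Fin n) => (X i ω, Y i ω)) X₀ P :=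
    h_test.comp (φ := fun (p : ℕ → EuclideanSpace ℝ (Fin d) × ℝ) (i : Fin n) => p i)
      (ψ := Prod.fst) (by fun_prop) measurable_fst
  have hm : ∀ i, Measurable fun ω => (X i ω, Y i ω) := fun i => (hX i).prodMk (hY i)
  rw [(indepFun_iff_map_prod_eq_prod_map_map
    (measurable_pi_iff.2 fun i : Fin n => hm i).aemeasurable hX₀.aemeasurable).1 h2,
    (iIndepFun_iff_map_fun_eq_pi_map fun i : Fin n => (hm i).aemeasurable).1 h1]
  simp only [(h_ident _).map_eq]

theorem map_train_points {d : ℕ} {Ω : Type*} [MeasurableSpace Ω] (P : Measure Ω)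
    [IsProbabilityMeasure P]
    {X : ℕ → Ω → EuclideanSpace ℝ (Fin d)} {Y : ℕ → Ω → ℝ}
    {X₀ : Ω → EuclideanSpace ℝ (Fin d)} {Y₀ : Ω → ℝ} (hX : ∀ i, Measurable (X i))
    (h_ident : ∀ i, IdentDistrib (fun ω => (X i ω, Y i ω)) (fun ω => (X₀ ω, Y₀ ω)) P P)
    (h_indep : iIndepFun (fun i ω => (X i ω, Y i ω)) P) (n : ℕ) :
    P.map (fun ω (i : Fin n) => X i ω) = Measure.pi fun _ => P.map X₀ := by
  have h1 : iIndepFun (fun (i : Fin n) ω => X i ω) P :=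
    (h_indep.precomp Fin.val_injective).comp (fun _ => Prod.fst) fun _ => measurable_fst
  rw [(iIndepFun_iff_map_fun_eq_pi_map fun i : Fin n => (hX i).aemeasurable).1 h1]
  have : ∀ i, P.map (X i) = P.map X₀ := fun i => ((h_ident i).comp measurable_fst).map_eq
  simp only [this]

theorem IsSimplePolytope.convex {d : ℕ} {K : Set (EuclideanSpace ℝ (Fin d))}
    (hK : IsSimplePolytope K) : Convex ℝ K := by
  obtain ⟨V, rfl⟩ := hK.isPolytope
  exact convex_convexHull ℝ _

theorem IsSimplePolytope.isCompact {d : ℕ} {K : Set (EuclideanSpace ℝ (Fin d))}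
    (hK : IsSimplePolytope K) : IsCompact K := by
  obtain ⟨V, rfl⟩ := hK.isPolytope
  exact V.finite_toSet.isCompact_convexHull ℝ

end SimplicialInterpolation

/-! ### Bounds and the limit of noise plus bias -/

namespace SimplicialInterpolation

open Topology

theorem ae_condExp_mem_Icc {Ω : Type*} {m m₀ : MeasurableSpace Ω} {P : Measure Ω}
    [IsProbabilityMeasure P] (hm : m ≤ m₀) {f : Ω → ℝ} (hf : Integrable f P)
    (h : ∀ᵐ ω ∂P, f ω ∈ Icc (0 : ℝ) 1) : ∀ᵐ ω ∂P, condExp m P f ω ∈ Icc (0 : ℝ) 1 := by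
  have h0 : 0 ≤ᵐ[P] condExp m P f := condExp_nonneg (h.mono fun ω hω => hω.1)
  have h1 : condExp m P f ≤ᵐ[P] condExp m P (fun _ => (1 : ℝ)) :=
    condExp_mono hf (integrable_const 1) (h.mono fun ω hω => hω.2)
  rw [condExp_const hm] at h1
  filter_upwards [h0, h1] with ω h0 h1 using ⟨h0, h1⟩

theorem measurable_indicator_of_continuousOn {d : ℕ} {K : Set (EuclideanSpace ℝ (Fin d))}
    (hK : MeasurableSet K) {g : EuclideanSpace ℝ (Fin d) → ℝ} (hg : ContinuousOn g K) :
    Measurable (K.indicator g) := by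
  classical
  rw [← piecewise_eq_indicator]
  exact hg.measurable_piecewise continuousOn_const hK

theorem abs_sum_mul_le_one {n : ℕ} {w u : Fin n → ℝ} (hw0 : ∀ i, 0 ≤ w i) (hw1 : ∑ i, w i ≤ 1)
    (hu : ∀ i, |u i| ≤ 1) : |∑ i, w i * u i| ≤ 1 := by
  refine (Finset.abs_sum_le_sum_abs _ _).trans ((Finset.sum_le_sum fun i _ => ?_).trans hw1)
  rw [abs_mul, abs_of_nonneg (hw0 i)]
  exact mul_le_of_le_one_right (hw0 i) (hu i)

/-- If the noise part is bounded and the bias vanishes, the noise alone determines the limit of the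
mean squared error. -/
theorem tendsto_integral_sq_add {Ω : Type*} [MeasurableSpace Ω] {P : Measure Ω}
    [IsProbabilityMeasure P] {S B : ℕ → Ω → ℝ} (hS : ∀ n, Measurable (S n))
    (hB : ∀ n, Measurable (B n)) {C : ℝ} (hSb : ∀ n, ∀ᵐ ω ∂P, |S n ω| ≤ 1)
    (hBb : ∀ n, ∀ᵐ ω ∂P, |B n ω| ≤ C) (hB0 : ∀ᵐ ω ∂P, Tendsto (fun n => B n ω) atTop (𝓝 0))
    {L : ℝ} (hL : Tendsto (fun n => ∫ ω, S n ω ^ 2 ∂P) atTop (𝓝 L)) :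
    Tendsto (fun n => ∫ ω, (S n ω + B n ω) ^ 2 ∂P) atTop (𝓝 L) := by
  have hSi : ∀ n, Integrable (fun ω => S n ω ^ 2) P := fun n => by
    refine Integrable.of_bound (C := 1) ((hS n).pow_const 2).aestronglyMeasurable ?_
    filter_upwards [hSb n] with ω hω
    rw [Real.norm_eq_abs, abs_pow]
    exact pow_le_one₀ (abs_nonneg _) hω
  -- Beyond `S ^ 2`, the square has remainder `2 S B + B ^ 2`, which is bounded and tends to zero
  -- almost surely.
  have hbound : ∀ n, ∀ᵐ ω ∂P, ‖2 * S n ω * B n ω + B n ω ^ 2‖ ≤ 2 * C + C ^ 2 := fun n => by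
    filter_upwards [hSb n, hBb n] with ω h1 h2
    have h3 : |S n ω| * |B n ω| ≤ 1 * C :=
      mul_le_mul h1 h2 (abs_nonneg _) zero_le_one
    calc ‖2 * S n ω * B n ω + B n ω ^ 2‖ ≤ |2 * S n ω * B n ω| + |B n ω ^ 2| := abs_add_le _ _
      _ = 2 * (|S n ω| * |B n ω|) + |B n ω| ^ 2 := by
          rw [abs_mul, abs_mul, abs_pow, abs_two, mul_assoc]
      _ ≤ 2 * C + C ^ 2 := by
          have := pow_le_pow_left₀ (abs_nonneg _) h2 2
          linarith
  have hmeas : ∀ n, AEStronglyMeasurable (fun ω => 2 * S n ω * B n ω + B n ω ^ 2) P := fun n =>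
    ((((hS n).const_mul 2).mul (hB n)).add ((hB n).pow_const 2)).aestronglyMeasurable
  have hR : Tendsto (fun n => ∫ ω, (2 * S n ω * B n ω + B n ω ^ 2) ∂P) atTop
      (𝓝 (∫ _, (0 : ℝ) ∂P)) := by
    refine tendsto_integral_of_dominated_convergence (fun _ => 2 * C + C ^ 2) hmeas
      (integrable_const _) hbound ?_
    filter_upwards [hB0, ae_all_iff.2 hSb] with ω h0 h1
    have h2 : Tendsto (fun n => S n ω * B n ω) atTop (𝓝 0) := by
      refine squeeze_zero_norm (fun n => ?_) (by simpa using h0.abs)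
      rw [Real.norm_eq_abs, abs_mul]
      exact mul_le_of_le_one_left (abs_nonneg _) (h1 n)
    simpa [mul_assoc] using (h2.const_mul 2).add (h0.pow 2)
  rw [integral_zero] at hR
  have := hL.add hR
  rw [add_zero] at this
  refine this.congr fun n => ?_
  rw [← integral_add (hSi n) (Integrable.of_bound (hmeas n) _ (hbound n))]
  exact integral_congr_ae (Eventually.of_forall fun ω => by ring)

end SimplicialInterpolation

/-! ### The main theorem -/

open SimplicialInterpolation in
theorem mainTheorem6 {d : ℕ} (hd : 1 ≤ d)
    -- the training examples `(X i, Y i)` and the test example `(X₀, Y₀)`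
    {Ω : Type*} [MeasurableSpace Ω] (P : Measure Ω) [IsProbabilityMeasure P]
    (X : ℕ → Ω → EuclideanSpace ℝ (Fin d)) (Y : ℕ → Ω → ℝ)
    (X₀ : Ω → EuclideanSpace ℝ (Fin d)) (Y₀ : Ω → ℝ)
    (hX : ∀ i, Measurable (X i)) (hY : ∀ i, Measurable (Y i))
    (hX₀ : Measurable X₀) (hY₀ : Measurable Y₀)
    (h_ident : ∀ i, IdentDistrib (fun ω => (X i ω, Y i ω)) (fun ω => (X₀ ω, Y₀ ω)) P P)
    (h_indep : iIndepFun (fun i ω => (X i ω, Y i ω)) P)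
    (h_test : IndepFun (fun ω i => (X i ω, Y i ω)) (fun ω => (X₀ ω, Y₀ ω)) P)
    (h_range : ∀ᵐ ω ∂P, Y₀ ω ∈ Set.Icc (0 : ℝ) 1)
    -- the marginal distribution is uniform on a full-dimensional simple polytope
    (K : Set (EuclideanSpace ℝ (Fin d))) (hK : SimplicialInterpolation.IsSimplePolytope K)
    (h_unif : P.map X₀ = ProbabilityTheory.cond volume K)
    -- the conditional mean function and its smoothness
    (η : EuclideanSpace ℝ (Fin d) → ℝ)
    (hη : (fun ω => η (X₀ ω)) =ᵐ[P]
      condExp (MeasurableSpace.comap X₀ inferInstance) P Y₀)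
    (A α : ℝ≥0) (hα : 0 < α) (hη_smooth : HolderOnWith A α η K)
    -- the conditional variance function and its smoothness
    (v : EuclideanSpace ℝ (Fin d) → ℝ)
    (hv : (fun ω => v (X₀ ω)) =ᵐ[P]
      condVar (MeasurableSpace.comap X₀ inferInstance) Y₀ P)
    (A' α' : ℝ≥0) (hα' : 0 < α') (hv_smooth : HolderOnWith A' α' v K)
    -- the Delaunay triangulation scheme
    (T : ∀ n : ℕ, (Fin n → EuclideanSpace ℝ (Fin d)) → Set (Finset (Fin n)))
    (hT : ∀ (n : ℕ) (x : Fin n → EuclideanSpace ℝ (Fin d)),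
      affineSpan ℝ (Set.range x) = ⊤ →
        SimplicialInterpolation.IsDelaunayTriangulation x (T n x)) :
    (∀ n, d < n →
      Integrable (fun ω => (SimplicialInterpolation.etaHat T X Y n ω (X₀ ω) - η (X₀ ω)) ^ 2) P) ∧
    limsup (fun n => ((∫ ω, (SimplicialInterpolation.etaHat T X Y n ω (X₀ ω) - η (X₀ ω)) ^ 2 ∂P : ℝ)
        : EReal)) atTop ≤
      ((2 / ((d : ℝ) + 2) * ∫ ω, (Y₀ ω - η (X₀ ω)) ^ 2 ∂P : ℝ) : EReal) := by
  have hKc := hK.convex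
  have hKcpt := hK.isCompact
  have hKm : MeasurableSet K := hKcpt.measurableSet
  have hμP : IsProbabilityMeasure (ProbabilityTheory.cond volume K) :=
    h_unif ▸ Measure.isProbabilityMeasure_map hX₀.aemeasurable
  have hm : MeasurableSpace.comap X₀ inferInstance ≤ (inferInstance : MeasurableSpace Ω) :=
    hX₀.comap_le
  have hZ₀ : Measurable fun ω => (X₀ ω, Y₀ ω) := hX₀.prodMk hY₀
  have hZ : ∀ i, Measurable fun ω => (X i ω, Y i ω) := fun i => (hX i).prodMk (hY i)
  set ν := P.map fun ω => (X₀ ω, Y₀ ω) with hν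
  have hνP : IsProbabilityMeasure ν := Measure.isProbabilityMeasure_map hZ₀.aemeasurable
  have hηc : ContinuousOn η K := hη_smooth.continuousOn hα
  have hvc : ContinuousOn v K := hv_smooth.continuousOn hα'
  -- Regularity is known only on `K`; cutting off outside makes both functions Borel and changes
  -- nothing almost surely.
  set η' := K.indicator η
  set v' := K.indicator v
  have hη'm : Measurable η' := measurable_indicator_of_continuousOn hKm hηc
  have hv'm : Measurable v' := measurable_indicator_of_continuousOn hKm hvc
  -- the test point lies in the interior of `K`
  have h0int : ∀ᵐ ω ∂P, X₀ ω ∈ interior K := by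
    refine ae_of_ae_map (p := fun x => x ∈ interior K) hX₀.aemeasurable ?_
    rw [h_unif]
    filter_upwards [ae_cond_mem hKm,
      cond_absolutelyContinuous.ae_le (measure_eq_zero_iff_ae_notMem.1
        (hKc.addHaar_frontier volume))] with x hx hxf
    rw [hKcpt.isClosed.frontier_eq] at hxf
    by_contra hxi
    exact hxf ⟨hx, hxi⟩
  have h0K : ∀ᵐ ω ∂P, X₀ ω ∈ K := h0int.mono fun ω hω => interior_subset hω
  have hηη' : ∀ᵐ ω ∂P, η' (X₀ ω) = η (X₀ ω) := h0K.mono fun ω hω => indicator_of_mem hω _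
  have hvv' : ∀ᵐ ω ∂P, v' (X₀ ω) = v (X₀ ω) := h0K.mono fun ω hω => indicator_of_mem hω _
  -- the conditional mean and variance
  have hY₀i : Integrable Y₀ P := by
    refine Integrable.of_bound (C := 1) hY₀.aestronglyMeasurable ?_
    filter_upwards [h_range] with ω hω
    rw [Real.norm_of_nonneg hω.1]
    exact hω.2
  have hη'c : (fun ω => η' (X₀ ω)) =ᵐ[P] condExp (MeasurableSpace.comap X₀ inferInstance) P Y₀ :=
    EventuallyEq.trans hηη' hη
  have hη'I : ∀ᵐ ω ∂P, η' (X₀ ω) ∈ Icc (0 : ℝ) 1 := by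
    filter_upwards [hη'c, ae_condExp_mem_Icc hm hY₀i h_range] with ω h1 h2
    rwa [h1]
  have hnoise : ∀ᵐ ω ∂P, |Y₀ ω - η' (X₀ ω)| ≤ 1 := by
    filter_upwards [hη'I, h_range] with ω h1 h2
    rw [abs_le]
    constructor <;> linarith [h1.1, h1.2, h2.1, h2.2]
  have hsqI : ∀ᵐ ω ∂P, (Y₀ ω - η' (X₀ ω)) ^ 2 ∈ Icc (0 : ℝ) 1 := by
    filter_upwards [hnoise] with ω h
    exact ⟨sq_nonneg _, (sq_le_one_iff_abs_le_one _).2 h⟩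
  have hsqi : Integrable (fun ω => (Y₀ ω - η' (X₀ ω)) ^ 2) P := by
    refine Integrable.of_bound (C := 1)
      ((hY₀.sub (hη'm.comp hX₀)).pow_const 2).aestronglyMeasurable ?_
    filter_upwards [hsqI] with ω h
    rw [Real.norm_of_nonneg h.1]
    exact h.2
  have hv'c : (fun ω => v' (X₀ ω)) =ᵐ[P] condExp (MeasurableSpace.comap X₀ inferInstance) P
      (fun ω => (Y₀ ω - η' (X₀ ω)) ^ 2) := by
    refine EventuallyEq.trans hvv' (hv.trans (condExp_congr_ae ?_))
    filter_upwards [hη'c] with ω h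
    simp [h]
  have hv'I : ∀ᵐ ω ∂P, |v' (X₀ ω)| ≤ 1 := by
    filter_upwards [hv'c, ae_condExp_mem_Icc hm hsqi hsqI] with ω h1 h2
    rw [h1, abs_of_nonneg h2.1]
    exact h2.2
  have hmean : ∀ h : EuclideanSpace ℝ (Fin d) → ℝ, Measurable h → (∃ C, ∀ b, |h b| ≤ C) →
      ∫ a, (a.2 - η' a.1) * h a.1 ∂ν = 0 := fun h hh hhb => by
    rw [hν, integral_map hZ₀.aemeasurable (by fun_prop)]
    exact integral_condExp_mul hX₀ hY₀i hη'c hh hhb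
  have hvar : ∀ h : EuclideanSpace ℝ (Fin d) → ℝ, Measurable h → (∃ C, ∀ b, |h b| ≤ C) →
      ∫ a, ((a.2 - η' a.1) ^ 2 - v' a.1) * h a.1 ∂ν = 0 := fun h hh hhb => by
    rw [hν, integral_map hZ₀.aemeasurable (by fun_prop)]
    exact integral_condExp_mul hX₀ hsqi hv'c hh hhb
  -- the training examples inherit the almost sure properties of the test example
  have hν1 : ∀ᵐ a ∂ν, |a.2 - η' a.1| ≤ 1 :=
    (ae_map_iff hZ₀.aemeasurable (measurableSet_le (by fun_prop) (by fun_prop))).2 hnoise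
  have hν2 : ∀ᵐ a ∂ν, |v' a.1| ≤ 1 :=
    (ae_map_iff hZ₀.aemeasurable (measurableSet_le (by fun_prop) (by fun_prop))).2 hv'I
  have hν3 : ∀ᵐ a ∂ν, a.1 ∈ K :=
    (ae_map_iff hZ₀.aemeasurable (measurable_fst hKm)).2 h0K
  have hν4 : ∀ᵐ a ∂ν, η' a.1 ∈ Icc (0 : ℝ) 1 :=
    (ae_map_iff hZ₀.aemeasurable ((hη'm.comp measurable_fst) measurableSet_Icc)).2 hη'I
  have hpull : ∀ {p : EuclideanSpace ℝ (Fin d) × ℝ → Prop}, (∀ᵐ a ∂ν, p a) →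
      ∀ᵐ ω ∂P, ∀ i, p (X i ω, Y i ω) := fun hp => ae_all_iff.2 fun i =>
    ae_of_ae_map (hZ i).aemeasurable ((h_ident i).map_eq ▸ hp)
  have hS1 := hpull hν1
  have hS2 := hpull hν2
  have hS3 := hpull hν3
  have hS4 := hpull hν4
  have hlaw : ∀ n : ℕ, P.map (fun ω (i : Fin n) => X i ω) =
      Measure.pi fun _ => ProbabilityTheory.cond volume K := fun n =>
    h_unif ▸ map_train_points P hX h_ident h_indep n
  -- measurable weights
  have hGex : ∀ n : ℕ, ∃ G ∈ ae (Measure.pi fun _ : Fin n => ProbabilityTheory.cond volume K),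
      MeasurableSet G ∧ ∀ x ∈ G, GeneralPosition x := fun n =>
    (ae_generalPosition hd _ cond_absolutelyContinuous).exists_measurable_mem
  choose G hGae hGm hGP using hGex
  have hXG : ∀ᵐ ω ∂P, ∀ n, (fun i : Fin n => X i ω) ∈ G n := ae_all_iff.2 fun n =>
    ae_of_ae_map (p := fun x => x ∈ G n) (measurable_pi_iff.2 fun i : Fin n => hX i).aemeasurable
      (by rw [hlaw n]; exact hGae n)
  -- Restriction to the full-measure set `G n` makes the chosen weights measurable.
  let W : ∀ n : ℕ, (Fin n → EuclideanSpace ℝ (Fin d)) × EuclideanSpace ℝ (Fin d) → Fin n → ℝ :=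
    fun n => (G n ×ˢ univ).indicator fun q => delaunayWeight q.1 q.2
  have hWm : ∀ n, Measurable (W n) := fun n => measurable_indicator_delaunayWeight (hGm n) (hGP n)
  let D : ∀ n : ℕ, Ω → Fin n → ℝ := fun n ω => W n (fun i => X i ω, X₀ ω)
  have hDm : ∀ n, Measurable (D n) := fun n => (hWm n).comp (by fun_prop)
  have hDim : ∀ n i, Measurable fun ω => D n ω i := fun n i => (measurable_pi_apply i).comp (hDm n)
  have hD : ∀ᵐ ω ∂P, ∀ n, D n ω = delaunayWeight (fun i : Fin n => X i ω) (X₀ ω) :=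
    hXG.mono fun ω hω n => indicator_of_mem (by simpa using hω n) _
  let S : ℕ → Ω → ℝ := fun n ω => ∑ i, D n ω i * (Y i ω - η' (X i ω))
  let B : ℕ → Ω → ℝ := fun n ω =>
    ∑ i, D n ω i * η' (X i ω) + (1 / 2) * (1 - ∑ i, D n ω i) - η' (X₀ ω)
  let V : ℕ → Ω → ℝ := fun n ω => ∑ i, D n ω i * v' (X i ω)
  have hSm : ∀ n, Measurable (S n) := fun n => Finset.measurable_fun_sum _ fun i _ =>
    (hDim n i).mul ((hY i).sub (hη'm.comp (hX i)))
  have hVm : ∀ n, Measurable (V n) := fun n => Finset.measurable_fun_sum _ fun i _ =>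
    (hDim n i).mul (hv'm.comp (hX i))
  have hBm : ∀ n, Measurable (B n) := fun n => by
    refine ((Finset.measurable_fun_sum _ fun i _ => (hDim n i).mul (hη'm.comp (hX i))).add
      ((measurable_const.sub (Finset.measurable_fun_sum _ fun i _ => hDim n i)).const_mul _)).sub
      (hη'm.comp hX₀)
  have hSb : ∀ n, ∀ᵐ ω ∂P, |S n ω| ≤ 1 := fun n => by
    filter_upwards [hD, hS1] with ω h h'
    simp only [S, h n]
    exact abs_sum_mul_le_one delaunayWeight_nonneg sum_delaunayWeight_le fun i => h' i
  have hVb : ∀ n, ∀ᵐ ω ∂P, ‖V n ω‖ ≤ 1 := fun n => by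
    filter_upwards [hD, hS2] with ω h h'
    simp only [V, h n]
    exact abs_sum_mul_le_one delaunayWeight_nonneg sum_delaunayWeight_le fun i => h' i
  -- The three terms of `B` are at most `1`, `1 / 2` and `1` in absolute value.
  have hBb : ∀ n, ∀ᵐ ω ∂P, |B n ω| ≤ 3 := fun n => by
    filter_upwards [hD, hS4, hη'I] with ω h h' h0
    have h1 : |∑ i, D n ω i * η' (X i ω)| ≤ 1 := by
      rw [h n]
      exact abs_sum_mul_le_one delaunayWeight_nonneg sum_delaunayWeight_le fun i => by
        rw [abs_of_nonneg (h' i).1]; exact (h' i).2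
    have h2 : ∑ i, D n ω i ≤ 1 := by rw [h n]; exact sum_delaunayWeight_le
    have h3 : 0 ≤ ∑ i, D n ω i := by
      rw [h n]; exact Finset.sum_nonneg fun i _ => delaunayWeight_nonneg i
    rw [abs_le] at h1 ⊢
    constructor <;> simp only [B] <;> linarith [h1.1, h1.2, h0.1, h0.2]
  -- convergence of the weighted averages
  have hlim : ∀ᵐ ω ∂P, ∀ g : EuclideanSpace ℝ (Fin d) → ℝ, ContinuousOn g K →
      Tendsto (fun n => ∑ i, D n ω i * g (X i ω)) atTop (nhds (g (X₀ ω))) := by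
    filter_upwards [hD, hXG, hS3, h0int,
      ae_exists_mem_ball P hX hKm hKcpt.measure_ne_top hlaw] with ω hDω hGω hKω h0 hball g hg
    obtain ⟨δ, hδ, hδK⟩ := Metric.isOpen_iff.1 isOpen_interior _ h0
    simp only [hDω]
    refine tendsto_sum_delaunayWeight (p := fun i => X i ω) hδ
      (fun q r hr hqr => hball q r hr (hqr.trans (hδK.trans interior_subset))) ?_ hKω
      (hg _ (interior_subset h0))
    filter_upwards [eventually_gt_atTop d] with n hn hz
    exact (hT n _ ((hGP n _ (hGω n)).affineSpan_eq_top hn)).exists_weight hz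
  have hηK : ∀ x ∈ K, η' x = η x := fun x hx => indicator_of_mem hx _
  have hvK : ∀ x ∈ K, v' x = v x := fun x hx => indicator_of_mem hx _
  have hB0 : ∀ᵐ ω ∂P, Tendsto (fun n => B n ω) atTop (nhds 0) := by
    filter_upwards [hlim] with ω h
    have h1 := h η' (hηc.congr hηK)
    have h2 := h (fun _ => 1) continuousOn_const
    simp only [mul_one] at h2
    simpa using (h1.add ((h2.const_sub 1).const_mul (1 / 2))).sub_const (η' (X₀ ω))
  have hVlim : Tendsto (fun n => ∫ ω, V n ω ∂P) atTop (nhds (∫ ω, v' (X₀ ω) ∂P)) := by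
    refine tendsto_integral_of_dominated_convergence (fun _ => 1)
      (fun n => (hVm n).aestronglyMeasurable) (integrable_const _) hVb ?_
    filter_upwards [hlim] with ω h using h v' (hvc.congr hvK)
  have hSV : ∀ n, ∫ ω, S n ω ^ 2 ∂P = 2 / (d + 2) * ∫ ω, V n ω ∂P := fun n => by
    have key := integral_sq_sum_noise_delaunayWeight ν hKc hν3 hη'm hv'm hν1 hν2 hmean hvar
      (hGm n) (hGP n) (W := W n) rfl
    have hjm : Measurable fun ω => ((fun i : Fin n => (X i ω, Y i ω)), X₀ ω) :=
      (measurable_pi_iff.2 fun i : Fin n => hZ i).prodMk hX₀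
    have hWim : ∀ i, Measurable fun q : (Fin n → EuclideanSpace ℝ (Fin d) × ℝ) ×
        EuclideanSpace ℝ (Fin d) => W n (fun k => (q.1 k).1, q.2) i := fun i =>
      (measurable_pi_apply i).comp ((hWm n).comp (by fun_prop))
    have hm1 : Measurable fun q : (Fin n → EuclideanSpace ℝ (Fin d) × ℝ) ×
        EuclideanSpace ℝ (Fin d) =>
        (∑ i, W n (fun k => (q.1 k).1, q.2) i * ((q.1 i).2 - η' (q.1 i).1)) ^ 2 :=
      (Finset.measurable_fun_sum _ fun i _ => (hWim i).mul (by fun_prop)).pow_const 2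
    have hm2 : Measurable fun q : (Fin n → EuclideanSpace ℝ (Fin d) × ℝ) ×
        EuclideanSpace ℝ (Fin d) => ∑ i, W n (fun k => (q.1 k).1, q.2) i * v' (q.1 i).1 :=
      Finset.measurable_fun_sum _ fun i _ => (hWim i).mul (by fun_prop)
    rw [← h_unif, hν, ← map_train_test P hX hY hX₀ h_ident h_indep h_test n,
      integral_map hjm.aemeasurable hm1.aestronglyMeasurable,
      integral_map hjm.aemeasurable hm2.aestronglyMeasurable] at key
    exact key
  have hvint : ∫ ω, v' (X₀ ω) ∂P = ∫ ω, (Y₀ ω - η (X₀ ω)) ^ 2 ∂P := by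
    rw [integral_congr_ae hv'c, integral_condExp hm]
    exact integral_congr_ae (hηη'.mono fun ω hω => by simp only [hω])
  have hmain := tendsto_integral_sq_add hSm hBm hSb hBb hB0
    ((hVlim.const_mul (2 / ((d : ℝ) + 2))).congr fun n => (hSV n).symm)
  -- the error of the interpolant is the sum of noise and bias
  have herr : ∀ n, d < n →
      (fun ω => (etaHat T X Y n ω (X₀ ω) - η (X₀ ω)) ^ 2) =ᵐ[P]
        fun ω => (S n ω + B n ω) ^ 2 := fun n hn => by
    filter_upwards [hD, hXG, hηη'] with ω hDω hGω hηω
    have hgp := hGP n _ (hGω n)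
    rw [etaHat, (hT n _ (hgp.affineSpan_eq_top hn)).simplicialInterpolant_eq hgp]
    simp only [S, B, hDω n, hηω, mul_sub, Finset.sum_sub_distrib]
    ring
  refine ⟨fun n hn => ?_, ?_⟩
  · rw [integrable_congr (herr n hn)]
    refine Integrable.of_bound (C := 4 ^ 2)
      (((hSm n).add (hBm n)).pow_const 2).aestronglyMeasurable ?_
    filter_upwards [hSb n, hBb n] with ω h1 h2
    rw [Real.norm_eq_abs, abs_pow]
    exact pow_le_pow_left₀ (abs_nonneg _) ((abs_add_le _ _).trans (by linarith)) 2
  · rw [← hvint]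
    -- The error agrees with noise plus bias only once `d < n`, which suffices for the limit.
    refine (Tendsto.limsup_eq (EReal.tendsto_coe.2 (hmain.congr' ?_))).le
    filter_upwards [eventually_gt_atTop d] with n hn
    exact (integral_congr_ae (herr n hn)).symm
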